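/- **Setting.** A memoryless 3-user cognitive interference channel with cumulative message sharing has input alphabets $\mathcal X_1,\mathcal X_2,\mathcal X_3$ and output alphabets $\mathcal Y_1,\mathcal Y_2,\mathcal Y_3$ (non-empty standard Borel spaces, e.g. finite sets or $\mathbb R^d$) and a transition probability $W=P_{Y_1,Y_2,Y_3|X_1,X_2,X_3}$. A code of block length $N$ and rates $R_1,R_2,R_3\ge 0$ consists of independent messages $W_i$, uniform on $\{1,\dots,\lfloor 2^{NR_i}\rfloor\}$, encoding functions $X_1^N=f_1(W_1)$, $X_2^N=f_2(W_1,W_2)$, $X_3^N=f_3(W_1,W_2,W_3)$, and (measurable) decoding functions $\widehat W_i=g_i(Y_i^N)$, where the $N$ input letters pass independently through $W$, without feedback. Its error probability is $\max_i\mathbb P[\widehat W_i\ne W_i]$. The capacity region $\mathcal C(W)$ is the set of $(R_1,R_2,R_3)$ with $R_i\ge 0$ for which there is a sequence of codes, one for each $N$, whose error probability tends to $0$ as $N\to\infty$. Let $\mathcal O(W)$ be the set of $(R_1,R_2,R_3)\in\mathbb R^3$ for which there is an input distribution $P_{X_1,X_2,X_3}$ such that, for every joint conditional distribution $V=P_{Y_1,Y_2,Y_3|X_1,X_2,X_3}$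 with the same conditional marginals $P_{Y_i|X_1,X_2,X_3}$, $i=1,2,3$, as $W$, $$ \begin{aligned} R_1&\le I(Y_1;X_1,X_2,X_3),\\ R_2&\le I(Y_2;X_2,X_3\mid X_1),\\ R_3&\le I(Y_3;X_3\mid X_1,X_2),\\ R_2+R_3&\le I(Y_2;X_2,X_3\mid X_1)+I(Y_3;X_3\mid X_1,X_2,Y_2),\\ R_1+R_2+R_3&\le I(Y_1;X_1,X_2,X_3)+I(Y_2;X_2,X_3\mid X_1,Y_1)+I(Y_3;X_3\mid X_1,Y_1,X_2,Y_2), \end{aligned} $$ where the (conditional) mutual informations, in bits and with values in $[0,\infty]$, are taken under $P_{X_1,X_2,X_3}\,V$. **Theorem.** (i) $\mathcal C(W)\subseteq\overline{\mathcal O(W)}$ (closure in $\mathbb R^3$). (ii) If $\mathcal X_1,\mathcal X_2,\mathcal X_3$ are finite, then $\mathcal C(W)\subseteq\mathcal O(W)$. (iii) The bound reduces to the two-user bound of Rini et al. when $X_3$ and $Y_3$ are removed: if $W_2=P_{Y_1,Y_2|X_1,X_2}$ is a two-user channel and $W_2^+$ is the three-user channel obtained from it by adding one-point alphabets $\mathcal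 X_3,\mathcal Y_3$, then $(R_1,R_2,0)\in\mathcal O(W_2^+)$ if and only if there is an input distribution $P_{X_1,X_2}$ such that, for every joint conditional distribution of $(Y_1,Y_2)$ given $(X_1,X_2)$ with the same conditional marginals as $W_2$, $R_1\le I(Y_1;X_1,X_2)$, $R_2\le I(Y_2;X_2\mid X_1)$ and $R_1+R_2\le I(Y_1;X_1,X_2)+I(Y_2;X_2\mid X_1,Y_1)$. -/

import Mathlib

open MeasureTheory ProbabilityTheory InformationTheory Filter Topology
open scoped ENNReal

noncomputable section

namespace CIFC

/-- Mutual information `I(A;B)` in bits, for random variables `A`, `B` on `(Ω, μ)`: the divergence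
of the joint law from the product of the marginal laws. -/
def mutualInfo {Ω α β : Type*} [MeasurableSpace Ω] [MeasurableSpace α] [MeasurableSpace β]
    (μ : Measure Ω) (A : Ω → α) (B : Ω → β) : ℝ≥0∞ :=
  klDiv (μ.map fun ω => (A ω, B ω)) ((μ.map A).prod (μ.map B)) / ENNReal.ofReal (Real.log 2)

/-- Conditional mutual information `I(A;B|C)` in bits: the divergence of the law of `(C, A, B)`
from `P_C ⊗ (P_{A|C} × P_{B|C})`, the law under which `A` and `B` are independent given `C`. -/
def condMutualInfo {Ω α β γ : Type*} [MeasurableSpace Ω] [MeasurableSpace α]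
    [StandardBorelSpace α] [Nonempty α] [MeasurableSpace β] [StandardBorelSpace β] [Nonempty β]
    [MeasurableSpace γ] (μ : Measure Ω) [IsFiniteMeasure μ]
    (A : Ω → α) (B : Ω → β) (C : Ω → γ) : ℝ≥0∞ :=
  klDiv (μ.map fun ω => (C ω, A ω, B ω))
    ((μ.map C) ⊗ₘ (condDistrib A C μ ×ₖ condDistrib B C μ)) / ENNReal.ofReal (Real.log 2)

/-- A block code of length `N` with `M₁`, `M₂`, `M₃` messages and cumulative message sharing:
transmitter `i` knows the messages of users `1, …, i`, receiver `i` sees only its own output. -/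
structure Code (X₁ X₂ X₃ Y₁ Y₂ Y₃ : Type*) [MeasurableSpace Y₁] [MeasurableSpace Y₂]
    [MeasurableSpace Y₃] (N M₁ M₂ M₃ : ℕ) where
  enc₁ : Fin M₁ → Fin N → X₁
  enc₂ : Fin M₁ → Fin M₂ → Fin N → X₂
  enc₃ : Fin M₁ → Fin M₂ → Fin M₃ → Fin N → X₃
  dec₁ : (Fin N → Y₁) → Fin M₁
  dec₂ : (Fin N → Y₂) → Fin M₂
  dec₃ : (Fin N → Y₃) → Fin M₃
  measurable_dec₁ : Measurable dec₁
  measurable_dec₂ : Measurable dec₂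
  measurable_dec₃ : Measurable dec₃

section ThreeUser

variable {X₁ X₂ X₃ Y₁ Y₂ Y₃ : Type*}
  [MeasurableSpace X₁] [MeasurableSpace X₂] [MeasurableSpace X₃]
  [MeasurableSpace Y₁] [MeasurableSpace Y₂] [MeasurableSpace Y₃]

/-- The joint law of the messages `(w₁, w₂, w₃)` and of the block of channel outputs, when the
messages are independent and uniform and each letter of the block passes independently through the
channel `W` (memoryless, without feedback). -/
def Code.law {N M₁ M₂ M₃ : ℕ} (c : Code X₁ X₂ X₃ Y₁ Y₂ Y₃ N M₁ M₂ M₃)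
    (W : Kernel (X₁ × X₂ × X₃) (Y₁ × Y₂ × Y₃)) :
    Measure ((Fin M₁ × Fin M₂ × Fin M₃) × (Fin N → Y₁ × Y₂ × Y₃)) :=
  (uniformOn (Set.univ : Set (Fin M₁ × Fin M₂ × Fin M₃))) ⊗ₘ
    (Kernel.ofFunOfCountable fun w : Fin M₁ × Fin M₂ × Fin M₃ =>
      Measure.pi fun t : Fin N =>
        W (c.enc₁ w.1 t, c.enc₂ w.1 w.2.1 t, c.enc₃ w.1 w.2.1 w.2.2 t))

/-- The largest of the three probabilities that receiver `i` decodes its message wrongly. -/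
def Code.errorProb {N M₁ M₂ M₃ : ℕ} (c : Code X₁ X₂ X₃ Y₁ Y₂ Y₃ N M₁ M₂ M₃)
    (W : Kernel (X₁ × X₂ × X₃) (Y₁ × Y₂ × Y₃)) : ℝ≥0∞ :=
  max (c.law W {p | c.dec₁ (fun t => (p.2 t).1) ≠ p.1.1})
    (max (c.law W {p | c.dec₂ (fun t => (p.2 t).2.1) ≠ p.1.2.1})
      (c.law W {p | c.dec₃ (fun t => (p.2 t).2.2) ≠ p.1.2.2}))

/-- The capacity region: non-negative rate triples for which some sequence of codes, the `N`-th of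
block length `N` with message sets `{1, …, ⌊2^{N Rᵢ}⌋}`, has vanishing error probability. -/
def capacityRegion (W : Kernel (X₁ × X₂ × X₃) (Y₁ × Y₂ × Y₃)) : Set (ℝ × ℝ × ℝ) :=
  {R | 0 ≤ R.1 ∧ 0 ≤ R.2.1 ∧ 0 ≤ R.2.2 ∧
    ∃ c : ∀ N : ℕ, Code X₁ X₂ X₃ Y₁ Y₂ Y₃ N
        ⌊(2 : ℝ) ^ ((N : ℝ) * R.1)⌋₊ ⌊(2 : ℝ) ^ ((N : ℝ) * R.2.1)⌋₊
        ⌊(2 : ℝ) ^ ((N : ℝ) * R.2.2)⌋₊,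
      Tendsto (fun N => (c N).errorProb W) atTop (𝓝 0)}

/-- The two channels have the same conditional law of each single output `Yᵢ` given all inputs. -/
def SameMarginals (W V : Kernel (X₁ × X₂ × X₃) (Y₁ × Y₂ × Y₃)) : Prop :=
  V.fst = W.fst ∧ V.snd.fst = W.snd.fst ∧ V.snd.snd = W.snd.snd

end ThreeUser

section Bounds

variable {X₁ X₂ X₃ Y₁ Y₂ Y₃ : Type*}
  [MeasurableSpace X₁] [StandardBorelSpace X₁] [Nonempty X₁]
  [MeasurableSpace X₂] [StandardBorelSpace X₂] [Nonempty X₂]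
  [MeasurableSpace X₃] [StandardBorelSpace X₃] [Nonempty X₃]
  [MeasurableSpace Y₁] [StandardBorelSpace Y₁] [Nonempty Y₁]
  [MeasurableSpace Y₂] [StandardBorelSpace Y₂] [Nonempty Y₂]
  [MeasurableSpace Y₃] [StandardBorelSpace Y₃] [Nonempty Y₃]

/-- The five rate bounds, for the input law `P` and the channel `V`; the random variables are the
coordinates `((x₁, x₂, x₃), (y₁, y₂, y₃))` under the law `P ⊗ V`. -/
structure RateBounds (P : Measure (X₁ × X₂ × X₃)) [IsProbabilityMeasure P]
    (V : Kernel (X₁ × X₂ × X₃) (Y₁ × Y₂ × Y₃)) [IsMarkovKernel V] (R : ℝ × ℝ × ℝ) : Prop where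
  /-- `R₁ ≤ I(Y₁; X₁, X₂, X₃)` -/
  rate₁ : ENNReal.ofReal R.1 ≤ mutualInfo (P ⊗ₘ V) (fun ω => ω.2.1) (fun ω => ω.1)
  /-- `R₂ ≤ I(Y₂; X₂, X₃ | X₁)` -/
  rate₂ : ENNReal.ofReal R.2.1 ≤
    condMutualInfo (P ⊗ₘ V) (fun ω => ω.2.2.1) (fun ω => ω.1.2) (fun ω => ω.1.1)
  /-- `R₃ ≤ I(Y₃; X₃ | X₁, X₂)` -/
  rate₃ : ENNReal.ofReal R.2.2 ≤
    condMutualInfo (P ⊗ₘ V) (fun ω => ω.2.2.2) (fun ω => ω.1.2.2) (fun ω => (ω.1.1, ω.1.2.1))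
  /-- `R₂ + R₃ ≤ I(Y₂; X₂, X₃ | X₁) + I(Y₃; X₃ | X₁, X₂, Y₂)` -/
  rate₂₃ : ENNReal.ofReal (R.2.1 + R.2.2) ≤
    condMutualInfo (P ⊗ₘ V) (fun ω => ω.2.2.1) (fun ω => ω.1.2) (fun ω => ω.1.1) +
    condMutualInfo (P ⊗ₘ V) (fun ω => ω.2.2.2) (fun ω => ω.1.2.2)
      (fun ω => (ω.1.1, ω.1.2.1, ω.2.2.1))
  /-- `R₁ + R₂ + R₃ ≤ I(Y₁; X₁, X₂, X₃) + I(Y₂; X₂, X₃ | X₁, Y₁) + I(Y₃; X₃ | X₁, Y₁, X₂, Y₂)` -/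
  rate₁₂₃ : ENNReal.ofReal (R.1 + R.2.1 + R.2.2) ≤
    mutualInfo (P ⊗ₘ V) (fun ω => ω.2.1) (fun ω => ω.1) +
    condMutualInfo (P ⊗ₘ V) (fun ω => ω.2.2.1) (fun ω => ω.1.2) (fun ω => (ω.1.1, ω.2.1)) +
    condMutualInfo (P ⊗ₘ V) (fun ω => ω.2.2.2) (fun ω => ω.1.2.2)
      (fun ω => (ω.1.1, ω.2.1, ω.1.2.1, ω.2.2.1))

/-- Rate triples that satisfy the five bounds for some input law `P` and, with this same `P`, for
every choice of the joint channel law with the conditional marginals of `W`. -/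
def outerRegion (W : Kernel (X₁ × X₂ × X₃) (Y₁ × Y₂ × Y₃)) : Set (ℝ × ℝ × ℝ) :=
  {R | ∃ (P : Measure (X₁ × X₂ × X₃)) (_ : IsProbabilityMeasure P),
    ∀ (V : Kernel (X₁ × X₂ × X₃) (Y₁ × Y₂ × Y₃)) (_ : IsMarkovKernel V),
      SameMarginals W V → RateBounds P V R}

/-- The two-user bounds of Rini et al., user 1 being the primary user:
`R₁ ≤ I(Y₁; X₁, X₂)`, `R₂ ≤ I(Y₂; X₂ | X₁)`, `R₁ + R₂ ≤ I(Y₁; X₁, X₂) + I(Y₂; X₂ | X₁, Y₁)`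
for some input law and every joint channel law with the conditional marginals of `W`. -/
def twoUserOuterRegion (W : Kernel (X₁ × X₂) (Y₁ × Y₂)) : Set (ℝ × ℝ) :=
  {R | ∃ (P : Measure (X₁ × X₂)) (_ : IsProbabilityMeasure P),
    ∀ (V : Kernel (X₁ × X₂) (Y₁ × Y₂)) (_ : IsMarkovKernel V),
      V.fst = W.fst → V.snd = W.snd →
        ENNReal.ofReal R.1 ≤ mutualInfo (P ⊗ₘ V) (fun ω => ω.2.1) (fun ω => ω.1) ∧
        ENNReal.ofReal R.2 ≤
          condMutualInfo (P ⊗ₘ V) (fun ω => ω.2.2) (fun ω => ω.1.2) (fun ω => ω.1.1) ∧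
        ENNReal.ofReal (R.1 + R.2) ≤
          mutualInfo (P ⊗ₘ V) (fun ω => ω.2.1) (fun ω => ω.1) +
          condMutualInfo (P ⊗ₘ V) (fun ω => ω.2.2) (fun ω => ω.1.2) (fun ω => (ω.1.1, ω.2.1))}

end Bounds

/-- A two-user channel regarded as a three-user channel whose third user has one-point alphabets. -/
def addTrivialUser {X₁ X₂ Y₁ Y₂ : Type*} [MeasurableSpace X₁] [MeasurableSpace X₂]
    [MeasurableSpace Y₁] [MeasurableSpace Y₂] (W : Kernel (X₁ × X₂) (Y₁ × Y₂)) :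
    Kernel (X₁ × X₂ × Unit) (Y₁ × Y₂ × Unit) :=
  (W.comap (fun x : X₁ × X₂ × Unit => (x.1, x.2.1)) (by fun_prop)).map
    (fun y : Y₁ × Y₂ => (y.1, y.2, ()))

end CIFC

end

/-! The converse is a change of measure against test channels, used here in place of Fano's
inequality. Fix a code, a channel `V` with the marginals of `W`, and a channel `Q` under which blind
guessing is the best the receivers can do, so that joint success, averaged over the messages, has
probability at most `1 / K` for `K` messages. Since success is likely under `V`,
`log_mul_measure_le_klDiv_add` forces the divergence of the block laws to be about `log K`. By
`klDiv_pi` this divergence is additive over time, and averaging over messages and times leaves `N *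
∫ klDiv (V x) (Q x)` under `Code.inputLaw`. Decoding errors are events of single receivers and are
added by a union bound, so only the marginals of `V` matter; and the input law depends on the code
alone. Hence one input law serves every `V`, as the order of quantifiers in `outerRegion` demands.

Each of the five bounds has its own shape of `Q` (`testKernel₂`, ..., `testKernel₁₂₃`), in which the
law of an output may use only variables that do not give its message away. If `Q` is built from the
conditional laws of `P ⊗ₘ V` itself, the averaged divergence is exactly the right-hand side of the
bound (the `lintegral_klDiv_eq_...` lemmas). This gives all bounds up to a vanishing slack, hence
the closure statement.

For finite input alphabets the input laws have a convergent subsequence. Against a fixed `Q` at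
finite divergence from `V` the bound is linear in the input law and passes to the limit. The test
channel that is optimal for the limit law may have infinite divergence at inputs of limit mass zero;
it is therefore mixed with a little of `V`, which restores finiteness at a cost that tends to `0`
(`le_lintegral_klDiv_of_approx`).

The two-user statement is a relabelling: a one-point third user contributes no information and no
constraint on the channel. -/

noncomputable section

set_option linter.unusedSectionVars false

namespace CIFC

/-! ### Divergence: products, change of measure, domination, chain rules. -/

section Divergence

variable {α β γ : Type*} [MeasurableSpace α] [MeasurableSpace β] [MeasurableSpace γ]

/-- The divergence is invariant under measurable maps with a measurable left inverse. -/
lemma klDiv_map_of_leftInverse {μ ν : Measure α} [IsFiniteMeasure μ] [IsFiniteMeasure ν]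
    {f : α → β} {g : β → α} (hf : Measurable f) (hg : Measurable g)
    (hgf : Function.LeftInverse g f) :
    klDiv (μ.map f) (ν.map f) = klDiv μ ν := by
  refine le_antisymm (klDiv_map_le μ ν hf) ?_
  have h := klDiv_map_le (μ.map f) (ν.map f) hg
  rwa [Measure.map_map hg hf, Measure.map_map hg hf, hgf.comp_eq_id, Measure.map_id,
    Measure.map_id] at h

lemma klDiv_prod (μ ν : Measure α) (μ' ν' : Measure β) [IsProbabilityMeasure μ]
    [IsProbabilityMeasure ν] [IsProbabilityMeasure μ'] [IsProbabilityMeasure ν'] :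
    klDiv (μ.prod μ') (ν.prod ν') = klDiv μ ν + klDiv μ' ν' := by
  rw [← Measure.compProd_const, ← Measure.compProd_const, klDiv_compProd_eq_add]
  congr 1
  -- Both laws now have first factor `μ`; after swapping, `μ` is a common kernel and contributes
  -- nothing.
  rw [Measure.compProd_const, Measure.compProd_const,
    ← klDiv_map_of_leftInverse (f := Prod.swap) (g := Prod.swap) measurable_swap measurable_swap
      Prod.swap_leftInverse,
    Measure.prod_swap, Measure.prod_swap, ← Measure.compProd_const, ← Measure.compProd_const,
    klDiv_compProd_left]

/-- The divergence of product measures is the sum of the divergences of the factors. -/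
lemma klDiv_pi {n : ℕ} (μ ν : Fin n → Measure α) [∀ i, IsProbabilityMeasure (μ i)]
    [∀ i, IsProbabilityMeasure (ν i)] :
    klDiv (Measure.pi μ) (Measure.pi ν) = ∑ i, klDiv (μ i) (ν i) := by
  induction n with
  | zero => rw [Subsingleton.elim μ ν]; simp
  | succ n ih =>
    let e := MeasurableEquiv.piFinSuccAbove (fun _ : Fin (n + 1) => α) 0
    rw [← klDiv_map_of_leftInverse e.measurable e.symm.measurable e.left_inv,
      (measurePreserving_piFinSuccAbove μ 0).map_eq, (measurePreserving_piFinSuccAbove ν 0).map_eq,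
      klDiv_prod, ih, Fin.sum_univ_succ]
    simp

/-- Fenchel–Young: the convex conjugate of `klFun` is `exp a - 1`, and the `-1` is dropped. -/
lemma mul_le_klFun_add_exp {r : ℝ} (hr : 0 ≤ r) (a : ℝ) :
    a * r ≤ klFun r + Real.exp a := by
  rcases hr.eq_or_lt with rfl | hr
  · simp [klFun_zero]; positivity
  · have h := Real.add_one_le_exp (a - Real.log r)
    rw [Real.exp_sub, Real.exp_log hr, le_div_iff₀ hr] at h
    rw [klFun_apply]; nlinarith

/-- Change of measure: an event of probability `μ s` can only have probability `1 / K` under `ν` at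
the cost of a divergence of about `μ s * log K`. -/
lemma log_mul_measure_le_klDiv_add {μ ν : Measure α} [IsFiniteMeasure μ] [IsFiniteMeasure ν]
    (s : Set α) {K : ℝ} (hK : 1 ≤ K) :
    ENNReal.ofReal (Real.log K) * μ s ≤ klDiv μ ν + ENNReal.ofReal K * ν s := by
  by_cases hac : μ ≪ ν
  swap; · simp [hac]
  rw [klDiv_eq_lintegral_klFun_of_ac hac]
  calc ENNReal.ofReal (Real.log K) * μ s
      = ∫⁻ x in s, ENNReal.ofReal (Real.log K) * μ.rnDeriv ν x ∂ν := by
        rw [lintegral_const_mul _ (Measure.measurable_rnDeriv _ _),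
          Measure.setLIntegral_rnDeriv hac]
    _ ≤ ∫⁻ x in s, (ENNReal.ofReal (klFun (μ.rnDeriv ν x).toReal) + ENNReal.ofReal K) ∂ν := by
        refine lintegral_mono_ae (ae_restrict_of_ae ?_)
        filter_upwards [Measure.rnDeriv_ne_top μ ν] with x hx
        rw [← ENNReal.ofReal_add (klFun_nonneg ENNReal.toReal_nonneg) (by linarith)]
        conv_lhs => rw [← ENNReal.ofReal_toReal hx]
        rw [← ENNReal.ofReal_mul (Real.log_nonneg hK)]
        refine ENNReal.ofReal_le_ofReal ?_
        -- With `a = log K` the conjugate term `exp a` is `K`.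
        have h := mul_le_klFun_add_exp (r := (μ.rnDeriv ν x).toReal) ENNReal.toReal_nonneg
          (Real.log K)
        rwa [Real.exp_log (by linarith)] at h
    _ = ∫⁻ x in s, ENNReal.ofReal (klFun (μ.rnDeriv ν x).toReal) ∂ν + ENNReal.ofReal K * ν s := by
        rw [lintegral_add_right _ measurable_const, setLIntegral_const]
    _ ≤ _ := by gcongr; exact Measure.restrict_le_self

/-- For positive `r`, `s` this is an identity with `log s` in place of `log b`. It is meant for `r =
dμ/dν'` and `s = dν'/dν`. -/
lemma klFun_mul_add_le {r s b : ℝ} (hr : 0 ≤ r) (hs : 0 ≤ s) (hsb : s ≤ b) :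
    klFun (r * s) + s ≤ s * klFun r + (r * s) * Real.log b + 1 := by
  rcases hs.eq_or_lt with rfl | hs
  · simp [klFun_zero]
  rcases hr.eq_or_lt with rfl | hr
  · simp [klFun_zero]; linarith
  have h := mul_le_mul_of_nonneg_left (Real.log_le_log hs hsb) (mul_pos hr hs).le
  rw [klFun_apply, klFun_apply, Real.log_mul hr.ne' hs.ne']
  nlinarith

lemma rnDeriv_le_of_smul_le {μ ν : Measure α} [IsFiniteMeasure μ] [IsFiniteMeasure ν] {c : ℝ}
    (hc : 0 < c) (h : ENNReal.ofReal c • μ ≤ ν) :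
    ∀ᵐ x ∂ν, μ.rnDeriv ν x ≤ ENNReal.ofReal c⁻¹ := by
  refine ae_le_of_forall_setLIntegral_le_of_sigmaFinite (Measure.measurable_rnDeriv _ _)
    fun s hs _ => ?_
  rw [setLIntegral_const]
  refine (Measure.setLIntegral_rnDeriv_le s).trans ?_
  have := h s
  rw [Measure.smul_apply, smul_eq_mul] at this
  rw [ENNReal.ofReal_inv_of_pos hc, mul_comm, ← div_eq_mul_inv,
    ENNReal.le_div_iff_mul_le (by simp [hc]) (by simp), mul_comm]
  exact this

lemma absolutelyContinuous_of_smul_le {μ ν : Measure α} {c : ℝ} (hc : 0 < c)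
    (h : ENNReal.ofReal c • μ ≤ ν) : μ ≪ ν := by
  intro s hs
  have := h s
  rw [hs, Measure.smul_apply, smul_eq_mul, nonpos_iff_eq_zero, mul_eq_zero] at this
  rcases this with h | h
  · simp [hc.not_ge] at h
  · exact h

/-- Replacing the reference measure by one that dominates a multiple of it raises the divergence by
a constant at most. -/
lemma klDiv_le_add_of_smul_le {μ ν ν' : Measure α} [IsProbabilityMeasure μ]
    [IsProbabilityMeasure ν] [IsProbabilityMeasure ν'] {c : ℝ} (hc : 0 < c)
    (h : ENNReal.ofReal c • ν' ≤ ν) :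
    klDiv μ ν ≤ klDiv μ ν' + ENNReal.ofReal (Real.log c⁻¹) := by
  by_cases hac : μ ≪ ν'
  swap; · simp [hac]
  have hac' := absolutelyContinuous_of_smul_le hc h
  have hc1 : c ≤ 1 := by
    have := h Set.univ
    simpa using this
  have hlog : 0 ≤ Real.log c⁻¹ := Real.log_nonneg ((one_le_inv₀ hc).2 hc1)
  rw [klDiv_eq_lintegral_klFun_of_ac (hac.trans hac'), klDiv_eq_lintegral_klFun_of_ac hac]
  -- The added `1` is the integral of `dν'/dν` on the left and the mass of `ν` on the right, which
  -- supplies the terms `s` and `1` of `klFun_mul_add_le`.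
  refine (ENNReal.add_le_add_iff_right ENNReal.one_ne_top).1 ?_
  have hm1 : Measurable fun x => ENNReal.ofReal (klFun (μ.rnDeriv ν' x).toReal) := by fun_prop
  calc ∫⁻ x, ENNReal.ofReal (klFun (μ.rnDeriv ν x).toReal) ∂ν + 1
      = ∫⁻ x, (ENNReal.ofReal (klFun (μ.rnDeriv ν x).toReal) + ν'.rnDeriv ν x) ∂ν := by
        rw [lintegral_add_right _ (Measure.measurable_rnDeriv _ _), Measure.lintegral_rnDeriv hac',
          measure_univ]
    _ ≤ ∫⁻ x, (ν'.rnDeriv ν x * ENNReal.ofReal (klFun (μ.rnDeriv ν' x).toReal)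
          + μ.rnDeriv ν x * ENNReal.ofReal (Real.log c⁻¹) + 1) ∂ν := by
        refine lintegral_mono_ae ?_
        filter_upwards [rnDeriv_le_of_smul_le hc h, Measure.rnDeriv_mul_rnDeriv hac (κ := ν),
          Measure.rnDeriv_ne_top ν' ν, Measure.rnDeriv_ne_top μ ν] with x h1 h2 h3 h4
        have h5 : (μ.rnDeriv ν x).toReal = (μ.rnDeriv ν' x).toReal * (ν'.rnDeriv ν x).toReal := by
          rw [← h2, Pi.mul_apply, ENNReal.toReal_mul]
        have key := klFun_mul_add_le (r := (μ.rnDeriv ν' x).toReal) (s := (ν'.rnDeriv ν x).toReal)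
          (b := c⁻¹) ENNReal.toReal_nonneg ENNReal.toReal_nonneg
          (ENNReal.toReal_le_of_le_ofReal (inv_pos.2 hc).le h1)
        rw [← h5] at key
        have hk : 0 ≤ klFun (μ.rnDeriv ν' x).toReal := klFun_nonneg ENNReal.toReal_nonneg
        rw [← ENNReal.ofReal_toReal h3, ← ENNReal.ofReal_toReal h4, ← ENNReal.ofReal_one,
          ENNReal.toReal_ofReal ENNReal.toReal_nonneg,
          ← ENNReal.ofReal_mul ENNReal.toReal_nonneg, ← ENNReal.ofReal_mul ENNReal.toReal_nonneg,
          ← ENNReal.ofReal_add (klFun_nonneg ENNReal.toReal_nonneg) ENNReal.toReal_nonneg,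
          ← ENNReal.ofReal_add (by positivity) (by positivity),
          ← ENNReal.ofReal_add (by positivity) (by positivity)]
        exact ENNReal.ofReal_le_ofReal key
    _ = _ := by
        rw [lintegral_add_right _ measurable_const, lintegral_add_right _ (by fun_prop),
          lintegral_rnDeriv_mul hac' hm1.aemeasurable,
          lintegral_mul_const _ (Measure.measurable_rnDeriv _ _),
          Measure.lintegral_rnDeriv (hac.trans hac')]
        simp

/-- The divergence of composition-products over the same base measure is the average of the
divergences of the kernels. -/
lemma klDiv_compProd_right [MeasurableSpace.CountableOrCountablyGenerated α β]
    (μ : Measure α) [IsProbabilityMeasure μ] (κ η : Kernel α β) [IsMarkovKernel κ]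
    [IsMarkovKernel η] :
    klDiv (μ ⊗ₘ κ) (μ ⊗ₘ η) = ∫⁻ x, klDiv (κ x) (η x) ∂μ := by
  have hmeas : MeasurableSet {a | κ a ≪ η a} := Kernel.measurableSet_absolutelyContinuous κ η
  by_cases hac : ∀ᵐ a ∂μ, κ a ≪ η a
  · have hac' : μ ⊗ₘ κ ≪ μ ⊗ₘ η := Measure.AbsolutelyContinuous.compProd_right hac
    have heq : μ ⊗ₘ κ = (μ ⊗ₘ η).withDensity fun p => κ.rnDeriv η p.1 p.2 := by
      rw [← Measure.compProd_withDensity (Kernel.measurable_rnDeriv κ η)]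
      refine Measure.compProd_congr ?_
      filter_upwards [hac] with a ha using (Kernel.withDensity_rnDeriv_eq ha).symm
    have hd : (μ ⊗ₘ κ).rnDeriv (μ ⊗ₘ η) =ᵐ[μ ⊗ₘ η] fun p => κ.rnDeriv η p.1 p.2 := by
      conv_lhs => rw [heq]
      exact Measure.rnDeriv_withDensity _ (Kernel.measurable_rnDeriv κ η)
    rw [klDiv_eq_lintegral_klFun_of_ac hac',
      lintegral_congr_ae (g := fun p => ENNReal.ofReal (klFun (κ.rnDeriv η p.1 p.2).toReal))
        (by filter_upwards [hd] with p hp; rw [hp]),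
      Measure.lintegral_compProd (by fun_prop)]
    refine lintegral_congr_ae ?_
    filter_upwards [hac] with a ha
    rw [klDiv_eq_lintegral_klFun_of_ac ha]
    refine lintegral_congr_ae ?_
    filter_upwards [Kernel.rnDeriv_eq_rnDeriv_measure (κ := κ) (η := η) (a := a)] with y hy
    rw [hy]
  · rw [klDiv_of_not_ac (by rwa [Measure.absolutelyContinuous_compProd_right_iff])]
    symm
    have hpos : μ {a | κ a ≪ η a}ᶜ ≠ 0 := hac
    rw [eq_top_iff]
    calc (⊤ : ℝ≥0∞) = ∫⁻ x in {a | κ a ≪ η a}ᶜ, ⊤ ∂μ := by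
          rw [setLIntegral_const, ENNReal.top_mul hpos]
      _ = ∫⁻ x in {a | κ a ≪ η a}ᶜ, klDiv (κ x) (η x) ∂μ :=
          setLIntegral_congr_fun hmeas.compl fun x hx => (klDiv_of_not_ac hx).symm
      _ ≤ _ := setLIntegral_le_lintegral _ _

/-- Chain rule for two-stage kernels over the same base measure. -/
lemma klDiv_compProd_compProd (μ : Measure α) [IsProbabilityMeasure μ] (κ κ' : Kernel α β)
    [IsMarkovKernel κ] [IsMarkovKernel κ'] (η η' : Kernel (α × β) γ) [IsMarkovKernel η]
    [IsMarkovKernel η'] :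
    klDiv (μ ⊗ₘ (κ ⊗ₖ η)) (μ ⊗ₘ (κ' ⊗ₖ η')) =
      klDiv (μ ⊗ₘ κ) (μ ⊗ₘ κ') + klDiv ((μ ⊗ₘ κ) ⊗ₘ η) ((μ ⊗ₘ κ) ⊗ₘ η') := by
  rw [← klDiv_compProd_eq_add, ← Measure.compProd_assoc, ← Measure.compProd_assoc,
    klDiv_map_of_leftInverse (MeasurableEquiv.measurable _)
      (MeasurableEquiv.prodAssoc.measurable) MeasurableEquiv.prodAssoc.apply_symm_apply]

/-- Domination constants multiply along the stages of a kernel, which is where the powers of `1 - η`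
in the limit argument come from. -/
lemma smul_compProd_le {a b : ℝ} (ha : 0 ≤ a) {κ κ' : Kernel α β} [IsMarkovKernel κ]
    [IsMarkovKernel κ'] {η η' : Kernel (α × β) γ} [IsMarkovKernel η] [IsMarkovKernel η'] {x : α}
    (h : ENNReal.ofReal a • κ x ≤ κ' x)
    (h' : ∀ y, ENNReal.ofReal b • η (x, y) ≤ η' (x, y)) :
    ENNReal.ofReal (a * b) • (κ ⊗ₖ η) x ≤ (κ' ⊗ₖ η') x := by
  refine Measure.le_iff.2 fun s hs => ?_
  rw [Measure.smul_apply, Kernel.compProd_apply hs, Kernel.compProd_apply hs, smul_eq_mul,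
    ENNReal.ofReal_mul ha, mul_assoc, ← lintegral_const_mul _
      (Kernel.measurable_kernel_prodMk_left' hs x), ← smul_eq_mul, ← lintegral_smul_measure]
  refine (lintegral_mono' h fun y => ?_)
  exact h' y _

lemma smul_compProd_right_le {a : ℝ} {μ : Measure α} [IsProbabilityMeasure μ] {κ κ' : Kernel α β}
    [IsMarkovKernel κ] [IsMarkovKernel κ'] (h : ∀ x, ENNReal.ofReal a • κ x ≤ κ' x) :
    ENNReal.ofReal a • (μ ⊗ₘ κ) ≤ μ ⊗ₘ κ' := by
  refine Measure.le_iff.2 fun s hs => ?_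
  rw [Measure.smul_apply, Measure.compProd_apply hs, Measure.compProd_apply hs, smul_eq_mul,
    ← lintegral_const_mul _ (Kernel.measurable_kernel_prodMk_left hs)]
  exact lintegral_mono fun x => h x _

end Divergence

/-! ### Mutual informations as divergences from a test kernel. -/

section Information

variable {Ω α β γ δ : Type*} [MeasurableSpace Ω] [MeasurableSpace α] [MeasurableSpace β]
  [MeasurableSpace γ] [MeasurableSpace δ]

lemma map_compProd_comap (μ : Measure α) [IsProbabilityMeasure μ] (κ : Kernel β γ)
    [IsMarkovKernel κ] {g : α → β} (hg : Measurable g) :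
    (μ ⊗ₘ κ.comap g hg).map (Prod.map g id) = μ.map g ⊗ₘ κ := by
  have := Measure.isProbabilityMeasure_map (μ := μ) hg.aemeasurable
  ext s hs
  rw [Measure.map_apply (by fun_prop) hs, Measure.compProd_apply (hs.preimage (by fun_prop)),
    Measure.compProd_apply hs, lintegral_map (Kernel.measurable_kernel_prodMk_left hs) hg]
  rfl

lemma ofReal_log_two_ne_zero : ENNReal.ofReal (Real.log 2) ≠ 0 := by
  simpa using Real.log_pos one_lt_two

lemma mutualInfo_mul_log_two (μ : Measure Ω) [IsProbabilityMeasure μ] {A : Ω → α} {B : Ω → β}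
    (hA : Measurable A) (hB : Measurable B) :
    mutualInfo μ A B * ENNReal.ofReal (Real.log 2) =
      klDiv (μ.map fun ω => (B ω, A ω)) (μ.map B ⊗ₘ Kernel.const β (μ.map A)) := by
  have := Measure.isProbabilityMeasure_map (μ := μ) hA.aemeasurable
  have := Measure.isProbabilityMeasure_map (μ := μ) hB.aemeasurable
  have := Measure.isProbabilityMeasure_map (μ := μ) (hA.prodMk hB).aemeasurable
  rw [mutualInfo, ENNReal.div_mul_cancel ofReal_log_two_ne_zero ENNReal.ofReal_ne_top,
    ← klDiv_map_of_leftInverse (f := Prod.swap) (g := Prod.swap) measurable_swap measurable_swap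
      Prod.swap_leftInverse,
    Measure.prod_swap, Measure.compProd_const, Measure.map_map measurable_swap (by fun_prop)]
  rfl

/-- The conditional mutual information `I(A;B|C)` as the divergence of the conditional law of `A`
given `(B, C)` from that of `A` given `C`; the pair `(B, C)` is presented by a variable `D`. -/
lemma condMutualInfo_mul_log_two [StandardBorelSpace α] [Nonempty α] [StandardBorelSpace β]
    [Nonempty β] (μ : Measure Ω) [IsProbabilityMeasure μ] {A : Ω → α} {B : Ω → β} {C : Ω → γ}
    {D : Ω → δ} (hA : Measurable A) (hB : Measurable B) (hC : Measurable C)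
    {f : δ → γ} {g : γ × β → δ} {e : δ → γ × β} (hf : Measurable f) (hg : Measurable g)
    (he : Measurable e) (hfg : ∀ p, f (g p) = p.1) (heg : Function.LeftInverse e g)
    (hD : ∀ ω, D ω = g (C ω, B ω)) :
    condMutualInfo μ A B C * ENNReal.ofReal (Real.log 2) =
      klDiv (μ.map fun ω => (D ω, A ω)) (μ.map D ⊗ₘ (condDistrib A C μ).comap f hf) := by
  obtain rfl : D = fun ω => g (C ω, B ω) := funext hD
  have := Measure.isProbabilityMeasure_map (μ := μ) hC.aemeasurable
  have := Measure.isProbabilityMeasure_map (μ := μ) (hC.prodMk hB).aemeasurable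
  have := Measure.isProbabilityMeasure_map (μ := μ) (hC.prodMk (hA.prodMk hB)).aemeasurable
  have hK : (condDistrib A C μ).comap Prod.fst measurable_fst
      = ((condDistrib A C μ).comap f hf).comap g hg := by
    ext p : 1; simp [Kernel.comap_apply, hfg]
  have h2 : ((μ.map C) ⊗ₘ (condDistrib A C μ ×ₖ condDistrib B C μ)).map
      (fun p : γ × α × β => (g (p.1, p.2.2), p.2.1))
      = μ.map (fun ω => g (C ω, B ω)) ⊗ₘ (condDistrib A C μ).comap f hf := by
    have h3 : ((μ.map C) ⊗ₘ (condDistrib A C μ ×ₖ condDistrib B C μ)).map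
        (fun p : γ × α × β => ((p.1, p.2.2), p.2.1)) =
        (μ.map fun ω => (C ω, B ω)) ⊗ₘ (condDistrib A C μ).comap Prod.fst measurable_fst := by
      rw [← compProd_map_condDistrib hB.aemeasurable]
      ext s hs
      rw [Measure.map_apply (by fun_prop) hs, Measure.compProd_apply (hs.preimage (by fun_prop)),
        Measure.compProd_apply hs, Measure.lintegral_compProd
          (Kernel.measurable_kernel_prodMk_left hs)]
      refine lintegral_congr fun c => ?_
      -- Given `C`, the variable `B` is integrated outermost, so that the sections are in `A`.
      rw [Kernel.prod_apply, Measure.prod_apply_symm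
        (hs.preimage (by fun_prop) |>.preimage (by fun_prop))]
      rfl
    have h4 : μ.map (fun ω => g (C ω, B ω)) = (μ.map fun ω => (C ω, B ω)).map g := by
      rw [Measure.map_map hg (by fun_prop)]; rfl
    rw [h4, ← map_compProd_comap _ _ hg, ← hK, ← h3, Measure.map_map (by fun_prop) (by fun_prop)]
    rfl
  rw [condMutualInfo, ENNReal.div_mul_cancel ofReal_log_two_ne_zero ENNReal.ofReal_ne_top, ← h2,
    ← klDiv_map_of_leftInverse (f := fun p : γ × α × β => (g (p.1, p.2.2), p.2.1))
      (g := fun q : δ × α => ((e q.1).1, q.2, (e q.1).2)) (by fun_prop) (by fun_prop)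
      (fun p => by simp [heg _]), Measure.map_map (by fun_prop) (by fun_prop)]
  rfl

end Information

/-! ### Test channels. -/

section TestKernels

variable {X₁ X₂ X₃ Y₁ Y₂ Y₃ : Type*}
  [MeasurableSpace X₁] [MeasurableSpace X₂] [MeasurableSpace X₃]
  [MeasurableSpace Y₁] [MeasurableSpace Y₂] [MeasurableSpace Y₃]

/-- The law of `Y₂` given the inputs under which it depends on `x₁` only. -/
def testKernel₂ (X₂ X₃ : Type*) [MeasurableSpace X₂] [MeasurableSpace X₃] (q₂ : Kernel X₁ Y₂) :
    Kernel (X₁ × X₂ × X₃) Y₂ :=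
  q₂.comap (fun x => x.1) (by fun_prop)

/-- The law of `Y₃` given the inputs under which it depends on `x₁`, `x₂` only. -/
def testKernel₃ (X₃ : Type*) [MeasurableSpace X₃] (q₃ : Kernel (X₁ × X₂) Y₃) :
    Kernel (X₁ × X₂ × X₃) Y₃ :=
  q₃.comap (fun x => (x.1, x.2.1)) (by fun_prop)

/-- The law of `(Y₂, Y₃)` given the inputs under which `Y₂` depends on `x₁` only, and `Y₃` on
`x₁`, `x₂` and `y₂`. -/
def testKernel₂₃ (X₃ : Type*) [MeasurableSpace X₃] (q₂ : Kernel X₁ Y₂)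
    (q₃ : Kernel (X₁ × X₂ × Y₂) Y₃) : Kernel (X₁ × X₂ × X₃) (Y₂ × Y₃) :=
  testKernel₂ X₂ X₃ q₂ ⊗ₖ
    q₃.comap (fun p : (X₁ × X₂ × X₃) × Y₂ => (p.1.1, p.1.2.1, p.2)) (by fun_prop)

/-- The law of `(Y₁, Y₂, Y₃)` given the inputs under which `Y₁` is independent of the inputs, `Y₂`
depends on `x₁`, `y₁` only, and `Y₃` on `x₁`, `y₁`, `x₂`, `y₂`. -/
def testKernel₁₂₃ (X₃ : Type*) [MeasurableSpace X₃] (q₁ : Measure Y₁) (q₂ : Kernel (X₁ × Y₁) Y₂)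
    (q₃ : Kernel (X₁ × Y₁ × X₂ × Y₂) Y₃) : Kernel (X₁ × X₂ × X₃) (Y₁ × Y₂ × Y₃) :=
  Kernel.const _ q₁ ⊗ₖ
    (q₂.comap (fun p : (X₁ × X₂ × X₃) × Y₁ => (p.1.1, p.2)) (by fun_prop) ⊗ₖ
      q₃.comap (fun p : ((X₁ × X₂ × X₃) × Y₁) × Y₂ => (p.1.1.1, p.1.2, p.1.1.2.1, p.2))
        (by fun_prop))

instance (q₂ : Kernel X₁ Y₂) [IsMarkovKernel q₂] : IsMarkovKernel (testKernel₂ X₂ X₃ q₂) := by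
  rw [testKernel₂]; infer_instance

instance (q₃ : Kernel (X₁ × X₂) Y₃) [IsMarkovKernel q₃] : IsMarkovKernel (testKernel₃ X₃ q₃) := by
  rw [testKernel₃]; infer_instance

instance (q₂ : Kernel X₁ Y₂) [IsMarkovKernel q₂] (q₃ : Kernel (X₁ × X₂ × Y₂) Y₃)
    [IsMarkovKernel q₃] : IsMarkovKernel (testKernel₂₃ X₃ q₂ q₃) := by
  rw [testKernel₂₃]; infer_instance

instance (q₁ : Measure Y₁) [IsProbabilityMeasure q₁] (q₂ : Kernel (X₁ × Y₁) Y₂) [IsMarkovKernel q₂]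
    (q₃ : Kernel (X₁ × Y₁ × X₂ × Y₂) Y₃) [IsMarkovKernel q₃] :
    IsMarkovKernel (testKernel₁₂₃ X₃ q₁ q₂ q₃) := by
  rw [testKernel₁₂₃]; infer_instance

end TestKernels

/-! ### The optimal test channels give the mutual informations. -/

section Bounds

variable {X₁ X₂ X₃ Y₁ Y₂ Y₃ : Type*}
  [MeasurableSpace X₁] [StandardBorelSpace X₁] [Nonempty X₁]
  [MeasurableSpace X₂] [StandardBorelSpace X₂] [Nonempty X₂]
  [MeasurableSpace X₃] [StandardBorelSpace X₃] [Nonempty X₃]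
  [MeasurableSpace Y₁] [StandardBorelSpace Y₁] [Nonempty Y₁]
  [MeasurableSpace Y₂] [StandardBorelSpace Y₂] [Nonempty Y₂]
  [MeasurableSpace Y₃] [StandardBorelSpace Y₃] [Nonempty Y₃]
  (P : Measure (X₁ × X₂ × X₃)) [IsProbabilityMeasure P]
  (V : Kernel (X₁ × X₂ × X₃) (Y₁ × Y₂ × Y₃)) [IsMarkovKernel V]

/-- Here and in the next four lemmas the test channel is made of the conditional laws of `P ⊗ₘ V`;
averaging over `P` turns the pointwise divergence into one of joint laws. -/
lemma lintegral_klDiv_eq_mutualInfo :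
    ∫⁻ x, klDiv (V.fst x) ((P ⊗ₘ V).map (fun ω => ω.2.1)) ∂P =
      mutualInfo (P ⊗ₘ V) (fun ω => ω.2.1) (fun ω => ω.1) * ENNReal.ofReal (Real.log 2) := by
  have := Measure.isProbabilityMeasure_map (μ := P ⊗ₘ V) (f := fun ω => ω.2.1) (by fun_prop)
  rw [mutualInfo_mul_log_two _ (by fun_prop) (by fun_prop)]
  have h1 : (P ⊗ₘ V).map (fun ω => ω.1) = P := Measure.fst_compProd P V
  have h2 : (P ⊗ₘ V).map (fun ω => (ω.1, ω.2.1)) = P ⊗ₘ V.fst := by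
    rw [Kernel.fst_eq, Measure.compProd_map measurable_fst]; rfl
  rw [h1, h2, klDiv_compProd_right]
  rfl

lemma lintegral_klDiv_eq_condMutualInfo₂ :
    ∫⁻ x, klDiv (V.snd.fst x)
        (testKernel₂ X₂ X₃ (condDistrib (fun ω => ω.2.2.1) (fun ω => ω.1.1) (P ⊗ₘ V)) x) ∂P =
      condMutualInfo (P ⊗ₘ V) (fun ω => ω.2.2.1) (fun ω => ω.1.2) (fun ω => ω.1.1)
        * ENNReal.ofReal (Real.log 2) := by
  rw [condMutualInfo_mul_log_two (D := fun ω => ω.1) (f := fun x => x.1) (g := id) (e := id) _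
    (by fun_prop) (by fun_prop) (by fun_prop) (by fun_prop) (by fun_prop) (by fun_prop)
    (fun _ => rfl) (fun _ => rfl) (fun _ => rfl)]
  have h1 : (P ⊗ₘ V).map (fun ω => ω.1) = P := Measure.fst_compProd P V
  have h2 : (P ⊗ₘ V).map (fun ω => (ω.1, ω.2.2.1)) = P ⊗ₘ V.snd.fst := by
    rw [Kernel.fst_eq, Kernel.snd_eq, Measure.compProd_map measurable_fst,
      Measure.compProd_map measurable_snd, Measure.map_map (by fun_prop) (by fun_prop)]
    rfl
  rw [h1, h2, klDiv_compProd_right]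
  rfl

lemma lintegral_klDiv_eq_condMutualInfo₃ :
    ∫⁻ x, klDiv (V.snd.snd x)
        (testKernel₃ X₃
          (condDistrib (fun ω => ω.2.2.2) (fun ω => (ω.1.1, ω.1.2.1)) (P ⊗ₘ V)) x) ∂P =
      condMutualInfo (P ⊗ₘ V) (fun ω => ω.2.2.2) (fun ω => ω.1.2.2) (fun ω => (ω.1.1, ω.1.2.1))
        * ENNReal.ofReal (Real.log 2) := by
  rw [condMutualInfo_mul_log_two (D := fun ω => ω.1) (f := fun x => (x.1, x.2.1))
    (g := fun p => (p.1.1, p.1.2, p.2)) (e := fun x => ((x.1, x.2.1), x.2.2)) _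
    (by fun_prop) (by fun_prop) (by fun_prop) (by fun_prop) (by fun_prop) (by fun_prop)
    (fun _ => rfl) (fun _ => rfl) (fun _ => rfl)]
  have h1 : (P ⊗ₘ V).map (fun ω => ω.1) = P := Measure.fst_compProd P V
  have h2 : (P ⊗ₘ V).map (fun ω => (ω.1, ω.2.2.2)) = P ⊗ₘ V.snd.snd := by
    rw [Kernel.snd_eq, Kernel.snd_eq, Measure.compProd_map measurable_snd,
      Measure.compProd_map measurable_snd, Measure.map_map (by fun_prop) (by fun_prop)]
    rfl
  rw [h1, h2, klDiv_compProd_right]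
  rfl

lemma lintegral_klDiv_eq_condMutualInfo₂₃ :
    ∫⁻ x, klDiv (V.snd x)
        (testKernel₂₃ X₃ (condDistrib (fun ω => ω.2.2.1) (fun ω => ω.1.1) (P ⊗ₘ V))
          (condDistrib (fun ω => ω.2.2.2) (fun ω => (ω.1.1, ω.1.2.1, ω.2.2.1)) (P ⊗ₘ V)) x) ∂P =
      (condMutualInfo (P ⊗ₘ V) (fun ω => ω.2.2.1) (fun ω => ω.1.2) (fun ω => ω.1.1) +
        condMutualInfo (P ⊗ₘ V) (fun ω => ω.2.2.2) (fun ω => ω.1.2.2)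
          (fun ω => (ω.1.1, ω.1.2.1, ω.2.2.1))) * ENNReal.ofReal (Real.log 2) := by
  rw [← klDiv_compProd_right, testKernel₂₃]
  -- Written in two stages, first `Y₂` and then `Y₃`, the channel matches the stages of the test
  -- kernel, and the chain rule gives one information term per stage.
  conv_lhs => rw [← V.snd.disintegrate V.snd.condKernel]
  rw [klDiv_compProd_compProd, add_mul, klDiv_compProd_right, lintegral_klDiv_eq_condMutualInfo₂]
  congr 1
  rw [condMutualInfo_mul_log_two (D := fun ω => (ω.1, ω.2.2.1))
    (f := fun p => (p.1.1, p.1.2.1, p.2))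
    (g := fun p => ((p.1.1, p.1.2.1, p.2), p.1.2.2))
    (e := fun q => ((q.1.1, q.1.2.1, q.2), q.1.2.2)) _
    (by fun_prop) (by fun_prop) (by fun_prop) (by fun_prop) (by fun_prop) (by fun_prop)
    (fun _ => rfl) (fun _ => rfl) (fun _ => rfl)]
  have h1 : (P ⊗ₘ V).map (fun ω => (ω.1, ω.2.2.1)) = P ⊗ₘ V.snd.fst := by
    rw [Kernel.fst_eq, Kernel.snd_eq, Measure.compProd_map measurable_fst,
      Measure.compProd_map measurable_snd, Measure.map_map (by fun_prop) (by fun_prop)]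
    rfl
  have h2 : (P ⊗ₘ V).map (fun ω => ((ω.1, ω.2.2.1), ω.2.2.2))
      = (P ⊗ₘ V.snd.fst) ⊗ₘ V.snd.condKernel := by
    rw [← Measure.compProd_assoc, V.snd.disintegrate V.snd.condKernel, Kernel.snd_eq,
      Measure.compProd_map measurable_snd, Measure.map_map (by fun_prop) (by fun_prop)]
    rfl
  rw [h1, h2]

lemma lintegral_klDiv_eq_condMutualInfo₁₂₃ :
    ∫⁻ x, klDiv (V x)
        (testKernel₁₂₃ X₃ ((P ⊗ₘ V).map (fun ω => ω.2.1))
          (condDistrib (fun ω => ω.2.2.1) (fun ω => (ω.1.1, ω.2.1)) (P ⊗ₘ V))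
          (condDistrib (fun ω => ω.2.2.2) (fun ω => (ω.1.1, ω.2.1, ω.1.2.1, ω.2.2.1))
            (P ⊗ₘ V)) x) ∂P =
      (mutualInfo (P ⊗ₘ V) (fun ω => ω.2.1) (fun ω => ω.1) +
        condMutualInfo (P ⊗ₘ V) (fun ω => ω.2.2.1) (fun ω => ω.1.2) (fun ω => (ω.1.1, ω.2.1)) +
        condMutualInfo (P ⊗ₘ V) (fun ω => ω.2.2.2) (fun ω => ω.1.2.2)
          (fun ω => (ω.1.1, ω.2.1, ω.1.2.1, ω.2.2.1))) * ENNReal.ofReal (Real.log 2) := by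
  have := Measure.isProbabilityMeasure_map (μ := P ⊗ₘ V) (f := fun ω => ω.2.1) (by fun_prop)
  rw [← klDiv_compProd_right, testKernel₁₂₃]
  conv_lhs =>
    arg 1
    rw [← V.disintegrate V.condKernel, ← V.condKernel.disintegrate V.condKernel.condKernel]
  rw [klDiv_compProd_compProd, klDiv_compProd_compProd, add_mul, add_mul, add_assoc]
  have h1 : (P ⊗ₘ V).map (fun ω => (ω.1, ω.2.1)) = P ⊗ₘ V.fst := by
    rw [Kernel.fst_eq, Measure.compProd_map measurable_fst]; rfl
  have h2 : (P ⊗ₘ V).map (fun ω => ((ω.1, ω.2.1), ω.2.2.1))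
      = (P ⊗ₘ V.fst) ⊗ₘ V.condKernel.fst := by
    rw [Kernel.fst_eq V.condKernel, Measure.compProd_map measurable_fst, ← Measure.compProd_assoc,
      V.disintegrate V.condKernel, Measure.map_map (by fun_prop) (by fun_prop)]
    rfl
  have h3 : (P ⊗ₘ V).map (fun ω => (((ω.1, ω.2.1), ω.2.2.1), ω.2.2.2))
      = ((P ⊗ₘ V.fst) ⊗ₘ V.condKernel.fst) ⊗ₘ V.condKernel.condKernel := by
    rw [← Measure.compProd_assoc, V.condKernel.disintegrate V.condKernel.condKernel,
      ← Measure.compProd_assoc, V.disintegrate V.condKernel,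
      Measure.map_map (by fun_prop) (by fun_prop)]
    rfl
  congr 1
  · rw [klDiv_compProd_right]
    exact lintegral_klDiv_eq_mutualInfo P V
  congr 1
  · rw [condMutualInfo_mul_log_two (D := fun ω => (ω.1, ω.2.1))
      (f := fun p => (p.1.1, p.2)) (g := fun p => ((p.1.1, p.2), p.1.2))
      (e := fun q => ((q.1.1, q.2), q.1.2)) _
      (by fun_prop) (by fun_prop) (by fun_prop) (by fun_prop) (by fun_prop) (by fun_prop)
      (fun _ => rfl) (fun _ => rfl) (fun _ => rfl), h1, h2]
  · rw [condMutualInfo_mul_log_two (D := fun ω => ((ω.1, ω.2.1), ω.2.2.1))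
      (f := fun p => (p.1.1.1, p.1.2, p.1.1.2.1, p.2))
      (g := fun p => (((p.1.1, p.1.2.2.1, p.2), p.1.2.1), p.1.2.2.2))
      (e := fun q => ((q.1.1.1, q.1.2, q.1.1.2.1, q.2), q.1.1.2.2)) _
      (by fun_prop) (by fun_prop) (by fun_prop) (by fun_prop) (by fun_prop) (by fun_prop)
      (fun _ => rfl) (fun _ => rfl) (fun _ => rfl), h2, h3]

end Bounds

/-! ### Blind guessing and coordinatewise images of product laws. -/

section Guessing

variable {Ω Z Z' : Type*} [MeasurableSpace Ω] [MeasurableSpace Z] [MeasurableSpace Z']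

/-- A decoder that does not know the message `b` is right for one value of `b` at a time. -/
lemma sum_measure_decode_le (ν : Measure Ω) {M : ℕ} {d : Ω → Fin M} (hd : Measurable d)
    (E : Set Ω) : ∑ b, ν {ω | ω ∈ E ∧ d ω = b} ≤ ν E := by
  have h := sum_measure_preimage_singleton (μ := ν.restrict E) (f := d) Finset.univ
    (fun b _ => hd (measurableSet_singleton b))
  calc ∑ b, ν {ω | ω ∈ E ∧ d ω = b} = ∑ b, ν.restrict E (d ⁻¹' {b}) := by
        refine Finset.sum_congr rfl fun b _ => ?_
        rw [Measure.restrict_apply (hd (measurableSet_singleton b)), Set.inter_comm]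
        rfl
    _ ≤ ν E := by rw [h]; simp

lemma pi_preimage {N : ℕ} (μ : Fin N → Measure Z) [∀ t, IsProbabilityMeasure (μ t)] {f : Z → Z'}
    (hf : Measurable f) {T : Set (Fin N → Z')} (hT : MeasurableSet T) :
    Measure.pi μ {z | (fun t => f (z t)) ∈ T} = Measure.pi (fun t => (μ t).map f) T := by
  have (t : Fin N) := Measure.isProbabilityMeasure_map (μ := μ t) hf.aemeasurable
  rw [← Measure.pi_map_pi (fun _ => hf.aemeasurable), Measure.map_apply (by fun_prop) hT]
  rfl

end Guessing

/-! ### From block codes to single-letter divergences. -/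

section Converse

variable {X₁ X₂ X₃ Y₁ Y₂ Y₃ Z : Type*}
  [MeasurableSpace X₁] [MeasurableSpace X₂] [MeasurableSpace X₃]
  [MeasurableSpace Y₁] [MeasurableSpace Y₂] [MeasurableSpace Y₃] [MeasurableSpace Z]
  {N M₁ M₂ M₃ : ℕ}

/-- The channel input at time `t` when the messages are `w`. -/
def Code.input (c : Code X₁ X₂ X₃ Y₁ Y₂ Y₃ N M₁ M₂ M₃) (w : Fin M₁ × Fin M₂ × Fin M₃)
    (t : Fin N) : X₁ × X₂ × X₃ :=
  (c.enc₁ w.1 t, c.enc₂ w.1 w.2.1 t, c.enc₃ w.1 w.2.1 w.2.2 t)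

/-- The law of the channel input at a uniformly chosen time, for uniform messages. -/
def Code.inputLaw (c : Code X₁ X₂ X₃ Y₁ Y₂ Y₃ N M₁ M₂ M₃) : Measure (X₁ × X₂ × X₃) :=
  ((M₁ * M₂ * M₃ : ℕ) * (N : ℝ≥0∞))⁻¹ • ∑ w, ∑ t, Measure.dirac (c.input w t)

lemma Code.isProbabilityMeasure_inputLaw (c : Code X₁ X₂ X₃ Y₁ Y₂ Y₃ N M₁ M₂ M₃) (hN : N ≠ 0)
    (hM : M₁ * M₂ * M₃ ≠ 0) : IsProbabilityMeasure c.inputLaw := by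
  constructor
  simp only [inputLaw, Measure.smul_apply, Measure.finsetSum_apply, measure_univ,
    Finset.sum_const, Finset.card_univ, Fintype.card_prod, Fintype.card_fin, smul_eq_mul,
    nsmul_eq_mul, mul_one, ← mul_assoc (M₁ : ℕ)]
  refine ENNReal.inv_mul_cancel ?_ ?_
  · exact mul_ne_zero (by exact_mod_cast hM) (by exact_mod_cast hN)
  · exact ENNReal.mul_ne_top (ENNReal.natCast_ne_top _) (ENNReal.natCast_ne_top _)

lemma Code.mul_lintegral_inputLaw [MeasurableSingletonClass (X₁ × X₂ × X₃)]
    (c : Code X₁ X₂ X₃ Y₁ Y₂ Y₃ N M₁ M₂ M₃) (hN : N ≠ 0)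
    (hM : M₁ * M₂ * M₃ ≠ 0) (f : X₁ × X₂ × X₃ → ℝ≥0∞) :
    (M₁ * M₂ * M₃ : ℕ) * (N * ∫⁻ x, f x ∂c.inputLaw) = ∑ w, ∑ t, f (c.input w t) := by
  simp only [inputLaw, lintegral_smul_measure, lintegral_finsetSum_measure, lintegral_dirac,
    smul_eq_mul]
  rw [← mul_assoc, ← mul_assoc, ENNReal.mul_inv_cancel, one_mul]
  · exact mul_ne_zero (by exact_mod_cast hM) (by exact_mod_cast hN)
  · exact ENNReal.mul_ne_top (ENNReal.natCast_ne_top _) (ENNReal.natCast_ne_top _)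

/-- If success has probability at most `1 / K` under the test channel `Q`, then `log K` is bounded
by the divergence of the channel `V` from `Q`, averaged over the channel inputs. -/
lemma Code.log_le_lintegral_klDiv [MeasurableSingletonClass (X₁ × X₂ × X₃)]
    (c : Code X₁ X₂ X₃ Y₁ Y₂ Y₃ N M₁ M₂ M₃) (hN : N ≠ 0) (hM : M₁ * M₂ * M₃ ≠ 0)
    (V Q : Kernel (X₁ × X₂ × X₃) Z) [IsMarkovKernel V] [IsMarkovKernel Q]
    (S : Fin M₁ × Fin M₂ × Fin M₃ → Set (Fin N → Z)) {K : ℝ} (hK : 1 ≤ K) {ε : ℝ≥0∞}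
    (hQ : ENNReal.ofReal K * ∑ w, Measure.pi (fun t => Q (c.input w t)) (S w) ≤
      (M₁ * M₂ * M₃ : ℕ))
    (hV : ∑ w, Measure.pi (fun t => V (c.input w t)) (S w)ᶜ ≤ (M₁ * M₂ * M₃ : ℕ) * ε) :
    ENNReal.ofReal (Real.log K) ≤
      N * ∫⁻ x, klDiv (V x) (Q x) ∂c.inputLaw + 1 + ENNReal.ofReal (Real.log K) * ε := by
  have hM0 : ((M₁ * M₂ * M₃ : ℕ) : ℝ≥0∞) ≠ 0 := by exact_mod_cast hM
  refine (ENNReal.mul_le_mul_iff_right hM0 (ENNReal.natCast_ne_top _)).1 ?_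
  -- Success and failure together carry the whole mass. Only subadditivity is used, so `S w` need
  -- not be measurable.
  have hone : ((M₁ * M₂ * M₃ : ℕ) : ℝ≥0∞) ≤
      ∑ w, Measure.pi (fun t => V (c.input w t)) (S w) + (M₁ * M₂ * M₃ : ℕ) * ε := by
    calc ((M₁ * M₂ * M₃ : ℕ) : ℝ≥0∞)
        = ∑ w : Fin M₁ × Fin M₂ × Fin M₃, Measure.pi (fun t => V (c.input w t)) Set.univ := by
          simp [mul_assoc]
      _ ≤ ∑ w, (Measure.pi (fun t => V (c.input w t)) (S w)
            + Measure.pi (fun t => V (c.input w t)) (S w)ᶜ) := by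
          refine Finset.sum_le_sum fun w _ => ?_
          rw [← Set.union_compl_self (S w)]
          exact measure_union_le _ _
      _ ≤ _ := by rw [Finset.sum_add_distrib]; gcongr
  calc ((M₁ * M₂ * M₃ : ℕ) : ℝ≥0∞) * ENNReal.ofReal (Real.log K)
      ≤ (∑ w, Measure.pi (fun t => V (c.input w t)) (S w) + (M₁ * M₂ * M₃ : ℕ) * ε)
          * ENNReal.ofReal (Real.log K) := by gcongr
    _ = ∑ w, ENNReal.ofReal (Real.log K) * Measure.pi (fun t => V (c.input w t)) (S w)
          + (M₁ * M₂ * M₃ : ℕ) * (ENNReal.ofReal (Real.log K) * ε) := by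
        rw [add_mul, mul_comm, Finset.mul_sum]; ring
    _ ≤ ∑ w, (∑ t, klDiv (V (c.input w t)) (Q (c.input w t))
          + ENNReal.ofReal K * Measure.pi (fun t => Q (c.input w t)) (S w))
          + (M₁ * M₂ * M₃ : ℕ) * (ENNReal.ofReal (Real.log K) * ε) := by
        gcongr with w
        rw [← klDiv_pi]
        exact log_mul_measure_le_klDiv_add _ hK
    _ ≤ (M₁ * M₂ * M₃ : ℕ) * (N * ∫⁻ x, klDiv (V x) (Q x) ∂c.inputLaw) + (M₁ * M₂ * M₃ : ℕ)
          + (M₁ * M₂ * M₃ : ℕ) * (ENNReal.ofReal (Real.log K) * ε) := by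
        rw [Finset.sum_add_distrib, ← Finset.mul_sum, c.mul_lintegral_inputLaw hN hM]
        gcongr
    _ = _ := by ring

lemma Code.law_apply (c : Code X₁ X₂ X₃ Y₁ Y₂ Y₃ N M₁ M₂ M₃) (hM : M₁ * M₂ * M₃ ≠ 0)
    (W : Kernel (X₁ × X₂ × X₃) (Y₁ × Y₂ × Y₃)) [IsMarkovKernel W]
    {s : Set ((Fin M₁ × Fin M₂ × Fin M₃) × (Fin N → Y₁ × Y₂ × Y₃))} (hs : MeasurableSet s) :
    (M₁ * M₂ * M₃ : ℕ) * c.law W s =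
      ∑ w, Measure.pi (fun t => W (c.input w t)) {y | (w, y) ∈ s} := by
  have hM0 : ((M₁ * M₂ * M₃ : ℕ) : ℝ≥0∞) ≠ 0 := by exact_mod_cast hM
  simp only [mul_ne_zero_iff] at hM
  have : Nonempty (Fin M₁ × Fin M₂ × Fin M₃) :=
    ⟨(⟨0, Nat.pos_of_ne_zero hM.1.1⟩, ⟨0, Nat.pos_of_ne_zero hM.1.2⟩, ⟨0, Nat.pos_of_ne_zero hM.2⟩)⟩
  have hu : IsProbabilityMeasure (uniformOn (Set.univ : Set (Fin M₁ × Fin M₂ × Fin M₃))) :=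
    isProbabilityMeasure_uniformOn Set.finite_univ Set.univ_nonempty
  have hk : IsMarkovKernel (Kernel.ofFunOfCountable fun w : Fin M₁ × Fin M₂ × Fin M₃ =>
      Measure.pi fun t : Fin N =>
        W (c.enc₁ w.1 t, c.enc₂ w.1 w.2.1 t, c.enc₃ w.1 w.2.1 w.2.2 t)) :=
    ⟨fun w => by
      change IsProbabilityMeasure (Measure.pi fun t : Fin N =>
        W (c.enc₁ w.1 t, c.enc₂ w.1 w.2.1 t, c.enc₃ w.1 w.2.1 w.2.2 t))
      infer_instance⟩
  rw [Code.law, Measure.compProd_apply hs, lintegral_fintype, Finset.mul_sum]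
  refine Finset.sum_congr rfl fun w _ => ?_
  have h1 : uniformOn (Set.univ : Set (Fin M₁ × Fin M₂ × Fin M₃)) {w}
      = ((M₁ * M₂ * M₃ : ℕ) : ℝ≥0∞)⁻¹ := by
    rw [uniformOn_univ]; simp [mul_assoc]
  rw [h1, mul_comm, mul_assoc, ENNReal.inv_mul_cancel hM0 (ENNReal.natCast_ne_top _), mul_one]
  rfl

variable (c : Code X₁ X₂ X₃ Y₁ Y₂ Y₃ N M₁ M₂ M₃)
  (W V : Kernel (X₁ × X₂ × X₃) (Y₁ × Y₂ × Y₃)) [IsMarkovKernel W] [IsMarkovKernel V]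

/-- The error event of one receiver sees only one marginal of the channel; this is what later allows
`V` to replace `W`. -/
lemma Code.sum_error_le₁ (hM : M₁ * M₂ * M₃ ≠ 0) :
    ∑ w, Measure.pi (fun t => W.fst (c.input w t)) {y | c.dec₁ y ≠ w.1} ≤
      (M₁ * M₂ * M₃ : ℕ) * c.errorProb W := by
  have hd := c.measurable_dec₁
  have hs : MeasurableSet {p : (Fin M₁ × Fin M₂ × Fin M₃) × (Fin N → Y₁ × Y₂ × Y₃) |
      c.dec₁ (fun t => (p.2 t).1) ≠ p.1.1} :=
    (measurableSet_eq_fun (hd.comp (by fun_prop)) (by fun_prop)).compl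
  refine le_trans (le_of_eq ?_) (mul_le_mul_right (le_max_left _ _) _)
  rw [c.law_apply hM W hs]
  refine Finset.sum_congr rfl fun w _ => ?_
  have hT : MeasurableSet {y | c.dec₁ y ≠ w.1} := (hd (measurableSet_singleton _)).compl
  simp_rw [Kernel.fst_apply]
  exact (pi_preimage _ measurable_fst hT).symm

lemma Code.sum_error_le₂ (hM : M₁ * M₂ * M₃ ≠ 0) :
    ∑ w, Measure.pi (fun t => W.snd.fst (c.input w t)) {y | c.dec₂ y ≠ w.2.1} ≤
      (M₁ * M₂ * M₃ : ℕ) * c.errorProb W := by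
  have hd := c.measurable_dec₂
  have hs : MeasurableSet {p : (Fin M₁ × Fin M₂ × Fin M₃) × (Fin N → Y₁ × Y₂ × Y₃) |
      c.dec₂ (fun t => (p.2 t).2.1) ≠ p.1.2.1} :=
    (measurableSet_eq_fun (hd.comp (by fun_prop)) (by fun_prop)).compl
  refine le_trans (le_of_eq ?_)
    (mul_le_mul_right ((le_max_left _ _).trans (le_max_right _ _)) _)
  rw [c.law_apply hM W hs]
  refine Finset.sum_congr rfl fun w _ => ?_
  have hT : MeasurableSet {y | c.dec₂ y ≠ w.2.1} := (hd (measurableSet_singleton _)).compl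
  simp_rw [Kernel.fst_apply, Kernel.snd_apply, Measure.map_map measurable_fst measurable_snd]
  exact (pi_preimage _ (measurable_fst.comp measurable_snd) hT).symm

lemma Code.sum_error_le₃ (hM : M₁ * M₂ * M₃ ≠ 0) :
    ∑ w, Measure.pi (fun t => W.snd.snd (c.input w t)) {y | c.dec₃ y ≠ w.2.2} ≤
      (M₁ * M₂ * M₃ : ℕ) * c.errorProb W := by
  have hd := c.measurable_dec₃
  have hs : MeasurableSet {p : (Fin M₁ × Fin M₂ × Fin M₃) × (Fin N → Y₁ × Y₂ × Y₃) |
      c.dec₃ (fun t => (p.2 t).2.2) ≠ p.1.2.2} :=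
    (measurableSet_eq_fun (hd.comp (by fun_prop)) (by fun_prop)).compl
  refine le_trans (le_of_eq ?_)
    (mul_le_mul_right ((le_max_right _ _).trans (le_max_right _ _)) _)
  rw [c.law_apply hM W hs]
  refine Finset.sum_congr rfl fun w _ => ?_
  have hT : MeasurableSet {y | c.dec₃ y ≠ w.2.2} := (hd (measurableSet_singleton _)).compl
  simp_rw [Kernel.snd_apply, Measure.map_map measurable_snd measurable_snd]
  exact (pi_preimage _ (measurable_snd.comp measurable_snd) hT).symm

end Converse

/-! ### What the joint test channels ignore, and their marginals. -/

section TestKernelMarginals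

variable {X₁ X₂ X₃ Y₁ Y₂ Y₃ : Type*}
  [MeasurableSpace X₁] [MeasurableSpace X₂] [MeasurableSpace X₃]
  [MeasurableSpace Y₁] [MeasurableSpace Y₂] [MeasurableSpace Y₃]

/-- Blindness to `x₃` makes the output law the same for all third messages, so the third decoder can
only guess. -/
lemma testKernel₂₃_congr (q₂ : Kernel X₁ Y₂) [IsMarkovKernel q₂] (q₃ : Kernel (X₁ × X₂ × Y₂) Y₃)
    [IsMarkovKernel q₃] (x₁ : X₁) (x₂ : X₂) (x₃ x₃' : X₃) :
    testKernel₂₃ X₃ q₂ q₃ (x₁, x₂, x₃) = testKernel₂₃ X₃ q₂ q₃ (x₁, x₂, x₃') := by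
  rw [testKernel₂₃, testKernel₂]
  ext s hs
  rw [Kernel.compProd_apply hs, Kernel.compProd_apply hs]
  rfl

lemma map_fst_testKernel₂₃ (q₂ : Kernel X₁ Y₂) [IsMarkovKernel q₂]
    (q₃ : Kernel (X₁ × X₂ × Y₂) Y₃) [IsMarkovKernel q₃] (x : X₁ × X₂ × X₃) :
    (testKernel₂₃ X₃ q₂ q₃ x).map Prod.fst = q₂ x.1 := by
  rw [← Kernel.fst_apply, testKernel₂₃, Kernel.fst_compProd]
  rfl

lemma testKernel₁₂₃_congr (q₁ : Measure Y₁) [IsProbabilityMeasure q₁] (q₂ : Kernel (X₁ × Y₁) Y₂)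
    [IsMarkovKernel q₂] (q₃ : Kernel (X₁ × Y₁ × X₂ × Y₂) Y₃) [IsMarkovKernel q₃]
    (x₁ : X₁) (x₂ : X₂) (x₃ x₃' : X₃) :
    testKernel₁₂₃ X₃ q₁ q₂ q₃ (x₁, x₂, x₃) = testKernel₁₂₃ X₃ q₁ q₂ q₃ (x₁, x₂, x₃') := by
  rw [testKernel₁₂₃]
  ext s hs
  rw [Kernel.compProd_apply hs, Kernel.compProd_apply hs]
  refine lintegral_congr fun y => ?_
  rw [Kernel.compProd_apply (measurable_prodMk_left hs),
    Kernel.compProd_apply (measurable_prodMk_left hs)]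
  rfl

lemma map_testKernel₁₂₃ (q₁ : Measure Y₁) [IsProbabilityMeasure q₁] (q₂ : Kernel (X₁ × Y₁) Y₂)
    [IsMarkovKernel q₂] (q₃ : Kernel (X₁ × Y₁ × X₂ × Y₂) Y₃) [IsMarkovKernel q₃]
    (x : X₁ × X₂ × X₃) :
    (testKernel₁₂₃ X₃ q₁ q₂ q₃ x).map (fun y => (y.1, y.2.1)) =
      (Kernel.const X₁ q₁ ⊗ₖ q₂) x.1 := by
  rw [testKernel₁₂₃]
  ext s hs
  rw [Measure.map_apply (by fun_prop) hs, Kernel.compProd_apply (hs.preimage (by fun_prop)),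
    Kernel.compProd_apply hs]
  refine lintegral_congr fun y => ?_
  have h : Prod.mk y ⁻¹' ((fun y : Y₁ × Y₂ × Y₃ => (y.1, y.2.1)) ⁻¹' s)
      = Prod.fst ⁻¹' (Prod.mk y ⁻¹' s) := rfl
  rw [h, ← Measure.map_apply measurable_fst (measurable_prodMk_left hs), ← Kernel.fst_apply,
    Kernel.fst_compProd]
  rfl

end TestKernelMarginals

/-! ### The five converse bounds against arbitrary test channels. -/

section Converse

variable {X₁ X₂ X₃ Y₁ Y₂ Y₃ : Type*}
  [MeasurableSpace X₁] [MeasurableSpace X₂] [MeasurableSpace X₃]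
  [MeasurableSpace Y₁] [MeasurableSpace Y₂] [MeasurableSpace Y₃]
  [MeasurableSingletonClass (X₁ × X₂ × X₃)]
  {N M₁ M₂ M₃ : ℕ} (c : Code X₁ X₂ X₃ Y₁ Y₂ Y₃ N M₁ M₂ M₃)
  {W V : Kernel (X₁ × X₂ × X₃) (Y₁ × Y₂ × Y₃)} [IsMarkovKernel W] [IsMarkovKernel V]

/-- Under `q₁` the output is independent of the messages, so `K = M₁` is admissible. The factor `3`
is needed only for the sum of all three rates; it is kept throughout so that all bounds share one
slack. -/
lemma Code.converse₁ (hN : N ≠ 0) (hM : M₁ * M₂ * M₃ ≠ 0) (hVW : SameMarginals W V)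
    (q₁ : Measure Y₁) [IsProbabilityMeasure q₁] :
    ENNReal.ofReal (Real.log M₁) ≤ N * ∫⁻ x, klDiv (V.fst x) q₁ ∂c.inputLaw + 1
      + ENNReal.ofReal (Real.log M₁) * (3 * c.errorProb W) := by
  have hK : (1 : ℝ) ≤ M₁ := by
    simp only [mul_ne_zero_iff] at hM; exact_mod_cast Nat.pos_of_ne_zero hM.1.1
  refine c.log_le_lintegral_klDiv hN hM V.fst (Kernel.const _ q₁) (fun w => {y | c.dec₁ y = w.1})
    hK ?_ ?_
  · have h := sum_measure_decode_le (Measure.pi fun _ : Fin N => q₁) c.measurable_dec₁ Set.univ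
    simp only [Set.mem_univ, true_and, measure_univ] at h
    simp only [Kernel.const_apply, Fintype.sum_prod_type, Finset.sum_const, Finset.card_univ,
      Fintype.card_prod, Fintype.card_fin, nsmul_eq_mul, ENNReal.ofReal_natCast, ← Finset.mul_sum]
    calc (M₁ : ℝ≥0∞) * _ ≤ M₁ * ((M₂ * M₃ : ℕ) * 1) := by gcongr
      _ = _ := by push_cast; ring
  · rw [hVW.1]
    refine (c.sum_error_le₁ W hM).trans ?_
    gcongr
    exact le_mul_of_one_le_left zero_le (by norm_num)

lemma Code.converse₂ (hN : N ≠ 0) (hM : M₁ * M₂ * M₃ ≠ 0) (hVW : SameMarginals W V)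
    (q₂ : Kernel X₁ Y₂) [IsMarkovKernel q₂] :
    ENNReal.ofReal (Real.log M₂) ≤
      N * ∫⁻ x, klDiv (V.snd.fst x) (testKernel₂ X₂ X₃ q₂ x) ∂c.inputLaw + 1
      + ENNReal.ofReal (Real.log M₂) * (3 * c.errorProb W) := by
  have hK : (1 : ℝ) ≤ M₂ := by
    simp only [mul_ne_zero_iff] at hM; exact_mod_cast Nat.pos_of_ne_zero hM.1.2
  refine c.log_le_lintegral_klDiv hN hM V.snd.fst (testKernel₂ X₂ X₃ q₂)
    (fun w => {y | c.dec₂ y = w.2.1}) hK ?_ ?_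
  · have h (w₁ : Fin M₁) := sum_measure_decode_le
      (Measure.pi fun t : Fin N => q₂ (c.enc₁ w₁ t)) c.measurable_dec₂ Set.univ
    simp only [Set.mem_univ, true_and, measure_univ] at h
    simp only [testKernel₂, Kernel.comap_apply, Code.input, Fintype.sum_prod_type,
      Finset.sum_const, Finset.card_univ, Fintype.card_fin, nsmul_eq_mul, ENNReal.ofReal_natCast,
      ← Finset.mul_sum]
    calc (M₂ : ℝ≥0∞) * _ ≤ M₂ * (M₃ * ∑ w₁ : Fin M₁, 1) := by gcongr with w₁; exact h w₁
      _ = _ := by simp; ring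
  · rw [hVW.2.1]
    refine (c.sum_error_le₂ W hM).trans ?_
    gcongr
    exact le_mul_of_one_le_left zero_le (by norm_num)

lemma Code.converse₃ (hN : N ≠ 0) (hM : M₁ * M₂ * M₃ ≠ 0) (hVW : SameMarginals W V)
    (q₃ : Kernel (X₁ × X₂) Y₃) [IsMarkovKernel q₃] :
    ENNReal.ofReal (Real.log M₃) ≤
      N * ∫⁻ x, klDiv (V.snd.snd x) (testKernel₃ X₃ q₃ x) ∂c.inputLaw + 1
      + ENNReal.ofReal (Real.log M₃) * (3 * c.errorProb W) := by
  have hK : (1 : ℝ) ≤ M₃ := by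
    simp only [mul_ne_zero_iff] at hM; exact_mod_cast Nat.pos_of_ne_zero hM.2
  refine c.log_le_lintegral_klDiv hN hM V.snd.snd (testKernel₃ X₃ q₃)
    (fun w => {y | c.dec₃ y = w.2.2}) hK ?_ ?_
  · have h (w₁ : Fin M₁) (w₂ : Fin M₂) := sum_measure_decode_le
      (Measure.pi fun t : Fin N => q₃ (c.enc₁ w₁ t, c.enc₂ w₁ w₂ t)) c.measurable_dec₃ Set.univ
    simp only [Set.mem_univ, true_and, measure_univ] at h
    simp only [testKernel₃, Kernel.comap_apply, Code.input, Fintype.sum_prod_type,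
      ENNReal.ofReal_natCast]
    calc (M₃ : ℝ≥0∞) * _ ≤ M₃ * ∑ w₁ : Fin M₁, ∑ w₂ : Fin M₂, 1 := by
          gcongr with w₁ _ w₂; exact h w₁ w₂
      _ = _ := by simp; ring
  · rw [hVW.2.2]
    refine (c.sum_error_le₃ W hM).trans ?_
    gcongr
    exact le_mul_of_one_le_left zero_le (by norm_num)

/-- The messages are removed from the last to the first: for fixed `w₁`, `w₂` the third decoder
guesses, which leaves the event that the second is right; the law of that event depends on `w₁`
only, so the second decoder guesses too. -/
lemma Code.converse₂₃ [Nonempty X₃] (hN : N ≠ 0) (hM : M₁ * M₂ * M₃ ≠ 0)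
    (hVW : SameMarginals W V) (q₂ : Kernel X₁ Y₂) [IsMarkovKernel q₂]
    (q₃ : Kernel (X₁ × X₂ × Y₂) Y₃) [IsMarkovKernel q₃] :
    ENNReal.ofReal (Real.log (M₂ * M₃ : ℕ)) ≤
      N * ∫⁻ x, klDiv (V.snd x) (testKernel₂₃ X₃ q₂ q₃ x) ∂c.inputLaw + 1
      + ENNReal.ofReal (Real.log (M₂ * M₃ : ℕ)) * (3 * c.errorProb W) := by
  have hK : (1 : ℝ) ≤ (M₂ * M₃ : ℕ) := by
    simp only [mul_ne_zero_iff] at hM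
    exact_mod_cast Nat.pos_of_ne_zero (mul_ne_zero hM.1.2 hM.2)
  have hd₂ := c.measurable_dec₂
  have hd₃ := c.measurable_dec₃
  let S₂ (w : Fin M₂) : Set (Fin N → Y₂ × Y₃) := {z | c.dec₂ (fun t => (z t).1) = w}
  refine c.log_le_lintegral_klDiv hN hM V.snd (testKernel₂₃ X₃ q₂ q₃)
    (fun w => {z | z ∈ S₂ w.2.1 ∧ c.dec₃ (fun t => (z t).2) = w.2.2}) hK ?_ ?_
  · let x₀ : X₃ := Classical.arbitrary X₃
    have h : ∑ w, Measure.pi (fun t => testKernel₂₃ X₃ q₂ q₃ (c.input w t))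
        {z | z ∈ S₂ w.2.1 ∧ c.dec₃ (fun t => (z t).2) = w.2.2} ≤ M₁ := by
      simp only [Fintype.sum_prod_type]
      calc _ ≤ ∑ w₁ : Fin M₁, (1 : ℝ≥0∞) := ?_
        _ = M₁ := by simp
      gcongr with w₁
      calc _ ≤ ∑ w₂ : Fin M₂, Measure.pi (fun t => q₂ (c.enc₁ w₁ t)) {y | c.dec₂ y = w₂} := ?_
        _ ≤ 1 := by
          have h := sum_measure_decode_le (Measure.pi fun t : Fin N => q₂ (c.enc₁ w₁ t)) hd₂
            Set.univ
          simpa only [Set.mem_univ, true_and, measure_univ] using h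
      gcongr with w₂
      simp only [Code.input]
      -- With the third input frozen at `x₀`, the law no longer depends on `w₃` and the sum over
      -- `w₃` collapses.
      simp_rw [fun w₃ t => testKernel₂₃_congr q₂ q₃ (c.enc₁ w₁ t) (c.enc₂ w₁ w₂ t)
        (c.enc₃ w₁ w₂ w₃ t) x₀]
      refine (sum_measure_decode_le _ (hd₃.comp (by fun_prop)) (S₂ w₂)).trans (le_of_eq ?_)
      refine (pi_preimage _ measurable_fst (hd₂ (measurableSet_singleton w₂))).trans ?_
      simp_rw [map_fst_testKernel₂₃]
      rfl
    rw [ENNReal.ofReal_natCast]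
    calc ((M₂ * M₃ : ℕ) : ℝ≥0∞) * _ ≤ (M₂ * M₃ : ℕ) * M₁ := by gcongr
      _ = _ := by push_cast; ring
  -- Union bound: joint failure under `V` is charged to single receivers, whose laws are those under
  -- `W`.
  · calc _ ≤ ∑ w, (Measure.pi (fun t => W.snd.fst (c.input w t)) {y | c.dec₂ y ≠ w.2.1}
          + Measure.pi (fun t => W.snd.snd (c.input w t)) {y | c.dec₃ y ≠ w.2.2}) := ?_
      _ ≤ (M₁ * M₂ * M₃ : ℕ) * c.errorProb W + (M₁ * M₂ * M₃ : ℕ) * c.errorProb W := by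
          rw [Finset.sum_add_distrib]
          exact add_le_add (c.sum_error_le₂ W hM) (c.sum_error_le₃ W hM)
      _ = (M₁ * M₂ * M₃ : ℕ) * (2 * c.errorProb W) := by ring
      _ ≤ _ := by gcongr; norm_num
    gcongr with w
    rw [← hVW.2.1, ← hVW.2.2]
    simp_rw [Kernel.fst_apply V.snd, Kernel.snd_apply V.snd]
    have hT₂ : MeasurableSet {y | c.dec₂ y ≠ w.2.1} := (hd₂ (measurableSet_singleton _)).compl
    have hT₃ : MeasurableSet {y | c.dec₃ y ≠ w.2.2} := (hd₃ (measurableSet_singleton _)).compl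
    rw [← pi_preimage _ measurable_fst hT₂, ← pi_preimage _ measurable_snd hT₃]
    refine (measure_mono ?_).trans (measure_union_le _ _)
    intro z hz
    by_contra h
    simp only [Set.mem_union, Set.mem_ofPred_eq, not_or, not_not, ne_eq] at h
    exact hz h

lemma Code.converse₁₂₃ [Nonempty X₃] (hN : N ≠ 0) (hM : M₁ * M₂ * M₃ ≠ 0)
    (hVW : SameMarginals W V) (q₁ : Measure Y₁) [IsProbabilityMeasure q₁]
    (q₂ : Kernel (X₁ × Y₁) Y₂) [IsMarkovKernel q₂]
    (q₃ : Kernel (X₁ × Y₁ × X₂ × Y₂) Y₃) [IsMarkovKernel q₃] :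
    ENNReal.ofReal (Real.log (M₁ * M₂ * M₃ : ℕ)) ≤
      N * ∫⁻ x, klDiv (V x) (testKernel₁₂₃ X₃ q₁ q₂ q₃ x) ∂c.inputLaw + 1
      + ENNReal.ofReal (Real.log (M₁ * M₂ * M₃ : ℕ)) * (3 * c.errorProb W) := by
  have hK : (1 : ℝ) ≤ (M₁ * M₂ * M₃ : ℕ) := by exact_mod_cast Nat.pos_of_ne_zero hM
  have hd₁ := c.measurable_dec₁
  have hd₂ := c.measurable_dec₂
  have hd₃ := c.measurable_dec₃
  let S₁₂ (w₁ : Fin M₁) (w₂ : Fin M₂) : Set (Fin N → Y₁ × Y₂) :=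
    {z | z ∈ {z | c.dec₁ (fun t => (z t).1) = w₁} ∧ c.dec₂ (fun t => (z t).2) = w₂}
  have hS₁₂ (w₁) (w₂) : MeasurableSet (S₁₂ w₁ w₂) :=
    (hd₁.comp (by fun_prop) (measurableSet_singleton w₁)).inter
      (hd₂.comp (by fun_prop) (measurableSet_singleton w₂))
  refine c.log_le_lintegral_klDiv hN hM V (testKernel₁₂₃ X₃ q₁ q₂ q₃)
    (fun w => {z | z ∈ {z | (fun t => ((z t).1, (z t).2.1)) ∈ S₁₂ w.1 w.2.1} ∧
      c.dec₃ (fun t => (z t).2.2) = w.2.2}) hK ?_ ?_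
  · let x₀ : X₃ := Classical.arbitrary X₃
    rw [ENNReal.ofReal_natCast]
    refine mul_le_of_le_one_right' ?_
    simp only [Fintype.sum_prod_type]
    calc _ ≤ ∑ w₁ : Fin M₁, Measure.pi (fun _ : Fin N => q₁) {y | c.dec₁ y = w₁} := ?_
      _ ≤ 1 := by
        have h := sum_measure_decode_le (Measure.pi fun _ : Fin N => q₁) hd₁ Set.univ
        simpa only [Set.mem_univ, true_and, measure_univ] using h
    gcongr with w₁
    calc _ ≤ ∑ w₂ : Fin M₂, Measure.pi (fun t => (Kernel.const X₁ q₁ ⊗ₖ q₂) (c.enc₁ w₁ t))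
          (S₁₂ w₁ w₂) := ?_
      _ ≤ _ := by
        refine (sum_measure_decode_le _ (hd₂.comp (by fun_prop)) _).trans (le_of_eq ?_)
        refine (pi_preimage _ measurable_fst (hd₁ (measurableSet_singleton w₁))).trans ?_
        simp_rw [← Kernel.fst_apply, Kernel.fst_compProd]
        rfl
    gcongr with w₂
    simp only [Code.input]
    simp_rw [fun w₃ t => testKernel₁₂₃_congr q₁ q₂ q₃ (c.enc₁ w₁ t) (c.enc₂ w₁ w₂ t)
      (c.enc₃ w₁ w₂ w₃ t) x₀]
    refine (sum_measure_decode_le _ (hd₃.comp (by fun_prop)) _).trans (le_of_eq ?_)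
    refine (pi_preimage (f := fun y : Y₁ × Y₂ × Y₃ => (y.1, y.2.1)) _ (by fun_prop)
      (hS₁₂ w₁ w₂)).trans ?_
    simp_rw [map_testKernel₁₂₃]
  · calc _ ≤ ∑ w, (Measure.pi (fun t => W.fst (c.input w t)) {y | c.dec₁ y ≠ w.1}
          + Measure.pi (fun t => W.snd.fst (c.input w t)) {y | c.dec₂ y ≠ w.2.1}
          + Measure.pi (fun t => W.snd.snd (c.input w t)) {y | c.dec₃ y ≠ w.2.2}) := ?_
      _ ≤ (M₁ * M₂ * M₃ : ℕ) * c.errorProb W + (M₁ * M₂ * M₃ : ℕ) * c.errorProb W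
          + (M₁ * M₂ * M₃ : ℕ) * c.errorProb W := by
          rw [Finset.sum_add_distrib, Finset.sum_add_distrib]
          exact add_le_add (add_le_add (c.sum_error_le₁ W hM) (c.sum_error_le₂ W hM))
            (c.sum_error_le₃ W hM)
      _ = _ := by ring
    gcongr with w
    rw [← hVW.1, ← hVW.2.1, ← hVW.2.2]
    simp_rw [Kernel.fst_apply, Kernel.snd_apply, Measure.map_map measurable_fst measurable_snd,
      Measure.map_map measurable_snd measurable_snd]
    have hT₁ : MeasurableSet {y | c.dec₁ y ≠ w.1} := (hd₁ (measurableSet_singleton _)).compl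
    have hT₂ : MeasurableSet {y | c.dec₂ y ≠ w.2.1} := (hd₂ (measurableSet_singleton _)).compl
    have hT₃ : MeasurableSet {y | c.dec₃ y ≠ w.2.2} := (hd₃ (measurableSet_singleton _)).compl
    rw [← pi_preimage _ measurable_fst hT₁,
      ← pi_preimage _ (measurable_fst.comp measurable_snd) hT₂,
      ← pi_preimage _ (measurable_snd.comp measurable_snd) hT₃]
    refine (measure_mono ?_).trans
      ((measure_union_le _ _).trans (add_le_add_left (measure_union_le _ _) _))
    intro z hz
    by_contra h
    simp only [Set.mem_union, Set.mem_ofPred_eq, not_or, not_not, ne_eq] at h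
    exact hz h

end Converse

/-! ### Message counts, rates and units. -/

section Rates

lemma floor_two_rpow_pos {r : ℝ} (hr : 0 ≤ r) : 0 < ⌊(2 : ℝ) ^ r⌋₊ :=
  Nat.floor_pos.2 (Real.one_le_rpow one_le_two hr)

lemma log_floor_two_rpow_le {r : ℝ} (hr : 0 ≤ r) :
    Real.log ⌊(2 : ℝ) ^ r⌋₊ ≤ r * Real.log 2 := by
  rw [← Real.log_rpow two_pos]
  exact Real.log_le_log (by exact_mod_cast floor_two_rpow_pos hr) (Nat.floor_le (by positivity))

/-- Rounding down at most halves a number that is at least `1`, and `log 2 ≤ 1`. -/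
lemma sub_one_le_log_floor_two_rpow {r : ℝ} (hr : 0 ≤ r) :
    r * Real.log 2 - 1 ≤ Real.log ⌊(2 : ℝ) ^ r⌋₊ := by
  have h1 : (1 : ℝ) ≤ ⌊(2 : ℝ) ^ r⌋₊ := by exact_mod_cast floor_two_rpow_pos hr
  have h2 : (2 : ℝ) ^ r ≤ 2 * ⌊(2 : ℝ) ^ r⌋₊ := by
    linarith [Nat.lt_floor_add_one ((2 : ℝ) ^ r)]
  have h3 := Real.log_le_log (by positivity) h2
  rw [Real.log_rpow two_pos, Real.log_mul two_ne_zero (by positivity)] at h3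
  linarith [Real.log_two_lt_d9]

/-- The per-letter form of the bound on the number of messages. -/
lemma ofReal_rate_le {N : ℕ} (hN : N ≠ 0) {L r r' : ℝ} (hrr' : r ≤ r')
    (hlow : N * r - 3 ≤ L) (hup : L ≤ N * r) {D ε : ℝ≥0∞}
    (h : ENNReal.ofReal L ≤ N * D + 1 + ENNReal.ofReal L * ε) :
    ENNReal.ofReal r ≤ D + (4 * (N : ℝ≥0∞)⁻¹ + ENNReal.ofReal r' * ε) := by
  have hN0 : (N : ℝ≥0∞) ≠ 0 := by exact_mod_cast hN
  have hNt : (N : ℝ≥0∞) ≠ ⊤ := ENNReal.natCast_ne_top N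
  refine (ENNReal.mul_le_mul_iff_right hN0 hNt).1 ?_
  calc (N : ℝ≥0∞) * ENNReal.ofReal r = ENNReal.ofReal (N * r) := by
        rw [ENNReal.ofReal_mul (by positivity), ENNReal.ofReal_natCast]
    -- At most three floors lose one nat each; together with the `1` from the change of measure this
    -- makes the `4 / N` of the slack.
    _ ≤ ENNReal.ofReal (L + 3) := ENNReal.ofReal_le_ofReal (by linarith)
    _ ≤ ENNReal.ofReal L + ENNReal.ofReal 3 := ENNReal.ofReal_add_le
    _ ≤ N * D + 1 + ENNReal.ofReal (N * r') * ε + 3 := by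
        refine add_le_add (h.trans ?_) (by norm_num)
        gcongr
        exact hup.trans (by gcongr)
    _ = N * D + (N * (N : ℝ≥0∞)⁻¹ * 4 + N * (ENNReal.ofReal r' * ε)) := by
        rw [ENNReal.mul_inv_cancel hN0 hNt, ENNReal.ofReal_mul (by positivity),
          ENNReal.ofReal_natCast]
        ring
    _ = _ := by ring

lemma ofReal_le_of_mul_log_two_le {a b d : ℝ} {I δ : ℝ≥0∞} (hd : 0 ≤ d)
    (h : ENNReal.ofReal (b * Real.log 2) ≤ I * ENNReal.ofReal (Real.log 2) + δ)
    (hδ : δ ≤ ENNReal.ofReal (d * Real.log 2)) (hab : a ≤ b - d) : ENNReal.ofReal a ≤ I := by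
  have hl := Real.log_pos one_lt_two
  refine (ENNReal.mul_le_mul_iff_left ofReal_log_two_ne_zero ENNReal.ofReal_ne_top).1 ?_
  calc ENNReal.ofReal a * ENNReal.ofReal (Real.log 2)
      = ENNReal.ofReal (a * Real.log 2) := (ENNReal.ofReal_mul' hl.le).symm
    _ ≤ ENNReal.ofReal (b * Real.log 2 - d * Real.log 2) := by
        refine ENNReal.ofReal_le_ofReal ?_
        nlinarith
    _ = ENNReal.ofReal (b * Real.log 2) - ENNReal.ofReal (d * Real.log 2) :=
        ENNReal.ofReal_sub _ (by positivity)
    _ ≤ _ := tsub_le_iff_right.2 (h.trans (by gcongr))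

end Rates

/-! ### Test bounds for achievable rates, and the closure statement. -/

section Bounds

variable {X₁ X₂ X₃ Y₁ Y₂ Y₃ : Type*}
  [MeasurableSpace X₁] [StandardBorelSpace X₁] [Nonempty X₁]
  [MeasurableSpace X₂] [StandardBorelSpace X₂] [Nonempty X₂]
  [MeasurableSpace X₃] [StandardBorelSpace X₃] [Nonempty X₃]
  [MeasurableSpace Y₁] [StandardBorelSpace Y₁] [Nonempty Y₁]
  [MeasurableSpace Y₂] [StandardBorelSpace Y₂] [Nonempty Y₂]
  [MeasurableSpace Y₃] [StandardBorelSpace Y₃] [Nonempty Y₃]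

/-- The five rate bounds up to a slack `δ`, in nats, with the divergences from arbitrary test
channels in place of the mutual informations. -/
structure TestBounds (P : Measure (X₁ × X₂ × X₃)) (V : Kernel (X₁ × X₂ × X₃) (Y₁ × Y₂ × Y₃))
    (R : ℝ × ℝ × ℝ) (δ : ℝ≥0∞) : Prop where
  rate₁ : ∀ (q₁ : Measure Y₁) [IsProbabilityMeasure q₁],
    ENNReal.ofReal (R.1 * Real.log 2) ≤ ∫⁻ x, klDiv (V.fst x) q₁ ∂P + δ
  rate₂ : ∀ (q₂ : Kernel X₁ Y₂) [IsMarkovKernel q₂],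
    ENNReal.ofReal (R.2.1 * Real.log 2) ≤
      ∫⁻ x, klDiv (V.snd.fst x) (testKernel₂ X₂ X₃ q₂ x) ∂P + δ
  rate₃ : ∀ (q₃ : Kernel (X₁ × X₂) Y₃) [IsMarkovKernel q₃],
    ENNReal.ofReal (R.2.2 * Real.log 2) ≤
      ∫⁻ x, klDiv (V.snd.snd x) (testKernel₃ X₃ q₃ x) ∂P + δ
  rate₂₃ : ∀ (q₂ : Kernel X₁ Y₂) [IsMarkovKernel q₂] (q₃ : Kernel (X₁ × X₂ × Y₂) Y₃)
    [IsMarkovKernel q₃],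
    ENNReal.ofReal ((R.2.1 + R.2.2) * Real.log 2) ≤
      ∫⁻ x, klDiv (V.snd x) (testKernel₂₃ X₃ q₂ q₃ x) ∂P + δ
  rate₁₂₃ : ∀ (q₁ : Measure Y₁) [IsProbabilityMeasure q₁] (q₂ : Kernel (X₁ × Y₁) Y₂)
    [IsMarkovKernel q₂] (q₃ : Kernel (X₁ × Y₁ × X₂ × Y₂) Y₃) [IsMarkovKernel q₃],
    ENNReal.ofReal ((R.1 + R.2.1 + R.2.2) * Real.log 2) ≤
      ∫⁻ x, klDiv (V x) (testKernel₁₂₃ X₃ q₁ q₂ q₃ x) ∂P + δ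

/-- Every achievable rate triple satisfies the bounds against all test channels, for a sequence of
input laws that does not depend on the joint channel law, with vanishing slack. -/
lemma exists_testBounds (W : Kernel (X₁ × X₂ × X₃) (Y₁ × Y₂ × Y₃)) [IsMarkovKernel W]
    {R : ℝ × ℝ × ℝ} (hR : R ∈ capacityRegion W) :
    ∃ (P : ℕ → Measure (X₁ × X₂ × X₃)) (δ : ℕ → ℝ≥0∞), Tendsto δ atTop (𝓝 0) ∧
      ∀ N ≠ 0, IsProbabilityMeasure (P N) ∧
        ∀ (V : Kernel (X₁ × X₂ × X₃) (Y₁ × Y₂ × Y₃)) [IsMarkovKernel V],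
          SameMarginals W V → TestBounds (P N) V R (δ N) := by
  obtain ⟨h₁, h₂, h₃, c, hc⟩ := hR
  have hl := Real.log_pos one_lt_two
  refine ⟨fun N => (c N).inputLaw, fun N => 4 * (N : ℝ≥0∞)⁻¹ +
    ENNReal.ofReal ((R.1 + R.2.1 + R.2.2) * Real.log 2) * (3 * (c N).errorProb W), ?_, ?_⟩
  · have hA : Tendsto (fun N : ℕ => 4 * (N : ℝ≥0∞)⁻¹) atTop (𝓝 (4 * 0)) :=
      ENNReal.Tendsto.const_mul ENNReal.tendsto_inv_nat_nhds_zero (Or.inr (by simp))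
    have hB : Tendsto (fun N => ENNReal.ofReal ((R.1 + R.2.1 + R.2.2) * Real.log 2) *
        (3 * (c N).errorProb W)) atTop
        (𝓝 (ENNReal.ofReal ((R.1 + R.2.1 + R.2.2) * Real.log 2) * (3 * 0))) :=
      ENNReal.Tendsto.const_mul (ENNReal.Tendsto.const_mul hc (Or.inr (by simp)))
        (Or.inr ENNReal.ofReal_ne_top)
    simpa using hA.add hB
  intro N hN
  have hN' : (0 : ℝ) ≤ N := Nat.cast_nonneg N
  have p₁ := floor_two_rpow_pos (mul_nonneg hN' h₁)
  have p₂ := floor_two_rpow_pos (mul_nonneg hN' h₂)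
  have p₃ := floor_two_rpow_pos (mul_nonneg hN' h₃)
  have u₁ := log_floor_two_rpow_le (mul_nonneg hN' h₁)
  have u₂ := log_floor_two_rpow_le (mul_nonneg hN' h₂)
  have u₃ := log_floor_two_rpow_le (mul_nonneg hN' h₃)
  have l₁ := sub_one_le_log_floor_two_rpow (mul_nonneg hN' h₁)
  have l₂ := sub_one_le_log_floor_two_rpow (mul_nonneg hN' h₂)
  have l₃ := sub_one_le_log_floor_two_rpow (mul_nonneg hN' h₃)
  have hM := (mul_pos (mul_pos p₁ p₂) p₃).ne'
  refine ⟨(c N).isProbabilityMeasure_inputLaw hN hM, fun V _ hV => ⟨?_, ?_, ?_, ?_, ?_⟩⟩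
  · intro q₁ _
    exact ofReal_rate_le hN (by gcongr; linarith) (by linarith) (by linarith)
      ((c N).converse₁ hN hM hV q₁)
  · intro q₂ _
    exact ofReal_rate_le hN (by gcongr; linarith) (by linarith) (by linarith)
      ((c N).converse₂ hN hM hV q₂)
  · intro q₃ _
    exact ofReal_rate_le hN (by gcongr; linarith) (by linarith) (by linarith)
      ((c N).converse₃ hN hM hV q₃)
  · intro q₂ _ q₃ _
    refine ofReal_rate_le hN (by gcongr; linarith) ?_ ?_
      ((c N).converse₂₃ hN hM hV q₂ q₃) <;>
    · rw [Nat.cast_mul, Real.log_mul (by positivity) (by positivity)]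
      linarith
  · intro q₁ _ q₂ _ q₃ _
    refine ofReal_rate_le hN le_rfl ?_ ?_
      ((c N).converse₁₂₃ hN hM hV q₁ q₂ q₃) <;>
    · rw [Nat.cast_mul, Nat.cast_mul, Real.log_mul (by positivity) (by positivity),
        Real.log_mul (by positivity) (by positivity)]
      linarith

/-- The test channels are chosen as the conditional laws under `P ⊗ₘ V`, hence depend on `V`, which
`TestBounds` permits. The sum bounds have room to spare: they lose `2 * d` or `3 * d`, and `d`
suffices. -/
lemma TestBounds.rateBounds {P : Measure (X₁ × X₂ × X₃)} [IsProbabilityMeasure P]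
    {V : Kernel (X₁ × X₂ × X₃) (Y₁ × Y₂ × Y₃)} [IsMarkovKernel V] {R : ℝ × ℝ × ℝ} {δ : ℝ≥0∞}
    (h : TestBounds P V R δ) {d : ℝ} (hd : 0 ≤ d) (hδ : δ ≤ ENNReal.ofReal (d * Real.log 2)) :
    RateBounds P V (R.1 - d, R.2.1 - d, R.2.2 - d) := by
  have := Measure.isProbabilityMeasure_map (μ := P ⊗ₘ V) (f := fun ω => ω.2.1) (by fun_prop)
  constructor
  · exact ofReal_le_of_mul_log_two_le hd
      (lintegral_klDiv_eq_mutualInfo P V ▸ h.rate₁ _) hδ le_rfl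
  · exact ofReal_le_of_mul_log_two_le hd
      (lintegral_klDiv_eq_condMutualInfo₂ P V ▸ h.rate₂ _) hδ le_rfl
  · exact ofReal_le_of_mul_log_two_le hd
      (lintegral_klDiv_eq_condMutualInfo₃ P V ▸ h.rate₃ _) hδ le_rfl
  · exact ofReal_le_of_mul_log_two_le hd
      (lintegral_klDiv_eq_condMutualInfo₂₃ P V ▸ h.rate₂₃ _ _) hδ (by simp only; linarith)
  · exact ofReal_le_of_mul_log_two_le hd
      (lintegral_klDiv_eq_condMutualInfo₁₂₃ P V ▸ h.rate₁₂₃ _ _ _) hδ (by simp only; linarith)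

theorem capacityRegion_subset_closure_outerRegion
    (W : Kernel (X₁ × X₂ × X₃) (Y₁ × Y₂ × Y₃)) [IsMarkovKernel W] :
    capacityRegion W ⊆ closure (outerRegion W) := by
  intro R hR
  obtain ⟨P, δ, hδ, h⟩ := exists_testBounds W hR
  have hl := Real.log_pos one_lt_two
  have hlim : Tendsto (fun d : ℝ => (R.1 - d, R.2.1 - d, R.2.2 - d)) (𝓝[>] 0) (𝓝 R) := by
    have : Continuous fun d : ℝ => (R.1 - d, R.2.1 - d, R.2.2 - d) := by fun_prop
    simpa using (this.tendsto 0).mono_left nhdsWithin_le_nhds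
  refine mem_closure_of_tendsto hlim ?_
  filter_upwards [self_mem_nhdsWithin] with d hd
  have hd' : 0 < ENNReal.ofReal (d * Real.log 2) := by
    simpa using mul_pos (Set.mem_Ioi.1 hd) hl
  -- The block length is chosen from `d` alone, so the input law is fixed before `V`.
  obtain ⟨N, hN, hN0⟩ := ((hδ.eventually_le_const hd').and (eventually_ne_atTop 0)).exists
  obtain ⟨hP, hV⟩ := h N hN0
  exact ⟨P N, hP, fun V _ hVW => (hV V hVW).rateBounds (le_of_lt hd) hN⟩

end Bounds

/-! ### Mixtures of test kernels with the channel. -/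

section Mixture

variable {C Y ι : Type*} [MeasurableSpace C] [MeasurableSpace Y]

/-- A mixture of Markov kernels that dominates multiples of all of them, the multiple of the first
one being close to `1`. -/
lemma exists_mixture [Finite ι] [Nonempty ι] (q₀ : Kernel C Y) [IsMarkovKernel q₀]
    (V : ι → Kernel C Y) [∀ i, IsMarkovKernel (V i)] {η : ℝ} (hη : 0 < η) (hη1 : η < 1) :
    ∃ q : Kernel C Y, IsMarkovKernel q ∧ (∀ c, ENNReal.ofReal (1 - η) • q₀ c ≤ q c) ∧
      ∃ a : ℝ, 0 < a ∧ ∀ i c, ENNReal.ofReal a • V i c ≤ q c := by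
  have := Fintype.ofFinite ι
  have hcard : (0 : ℝ) < Fintype.card ι := by exact_mod_cast Fintype.card_pos
  let q : Kernel C Y :=
    { toFun := fun c => ENNReal.ofReal (1 - η) • q₀ c
        + ENNReal.ofReal (η / Fintype.card ι) • ∑ i, V i c
      measurable' := by
        refine Measure.measurable_of_measurable_coe _ fun s hs => ?_
        simp only [Measure.add_apply, Measure.smul_apply, Measure.finsetSum_apply, smul_eq_mul]
        exact ((Kernel.measurable_coe _ hs).const_mul _).add
          ((Finset.measurable_sum _ fun i _ => Kernel.measurable_coe _ hs).const_mul _) }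
  have hq (c : C) : q c = ENNReal.ofReal (1 - η) • q₀ c
        + ENNReal.ofReal (η / Fintype.card ι) • ∑ i, V i c := rfl
  refine ⟨q, ⟨fun c => ⟨?_⟩⟩, fun c => ?_, η / Fintype.card ι, by positivity, fun i c => ?_⟩
  · simp only [hq, Measure.add_apply, Measure.smul_apply, Measure.finsetSum_apply, measure_univ,
      smul_eq_mul, mul_one, Finset.sum_const, Finset.card_univ, nsmul_eq_mul]
    rw [← ENNReal.ofReal_natCast, ← ENNReal.ofReal_mul (by positivity),
      div_mul_cancel₀ _ hcard.ne', ← ENNReal.ofReal_add (by linarith) hη.le]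
    simp
  · rw [hq]
    exact Measure.le_add_right le_rfl
  · rw [hq]
    refine Measure.le_add_left (Measure.le_iff.2 fun s hs => ?_)
    simp only [Measure.smul_apply, Measure.finsetSum_apply, smul_eq_mul]
    gcongr
    exact Finset.single_le_sum (f := fun i => V i c s) (fun _ _ => zero_le) (Finset.mem_univ i)

end Mixture

/-! ### Limits of input laws and of test channels. -/

section Limit

variable {X Z : Type*} [MeasurableSpace X] [MeasurableSpace Z]

/-- On a finite space the integral is a finite sum, linear in the point masses. Finiteness of `f`
matters: `∞ * P n {x}` need not converge when the mass of `x` tends to `0`. -/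
lemma le_lintegral_of_tendsto [Finite X] [MeasurableSingletonClass X] {P : ℕ → Measure X}
    {P' : Measure X} (hP : ∀ x, Tendsto (fun n => P n {x}) atTop (𝓝 (P' {x}))) {δ : ℕ → ℝ≥0∞}
    (hδ : Tendsto δ atTop (𝓝 0)) {f : X → ℝ≥0∞} (hf : ∀ x, f x ≠ ⊤) {r : ℝ≥0∞}
    (h : ∀ᶠ n in atTop, r ≤ ∫⁻ x, f x ∂P n + δ n) : r ≤ ∫⁻ x, f x ∂P' := by
  have := Fintype.ofFinite X
  have hlim : Tendsto (fun n => ∑ x, f x * P n {x} + δ n) atTop (𝓝 (∑ x, f x * P' {x} + 0)) :=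
    (tendsto_finsetSum _ fun x _ =>
      ENNReal.Tendsto.const_mul (hP x) (Or.inr (hf x))).add hδ
  simp only [lintegral_fintype] at h ⊢
  simpa using ge_of_tendsto hlim h

/-- A bound against test channels that stay at finite divergence from `V` extends to a test channel
that they approximate from above. -/
lemma le_lintegral_klDiv_of_approx [MeasurableSpace.CountableOrCountablyGenerated X Z]
    {P : Measure X} [IsProbabilityMeasure P] {V Q₀ : Kernel X Z} [IsMarkovKernel V]
    [IsMarkovKernel Q₀] {r : ℝ≥0∞} (k : ℕ)
    (h : ∀ η : ℝ, 0 < η → η < 1 → ∃ Q : Kernel X Z, IsMarkovKernel Q ∧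
      (∀ x, ENNReal.ofReal ((1 - η) ^ k) • Q₀ x ≤ Q x) ∧
      (∃ a : ℝ, 0 < a ∧ ∀ x, ENNReal.ofReal a • V x ≤ Q x) ∧
      ((∀ x, klDiv (V x) (Q x) ≠ ⊤) → r ≤ ∫⁻ x, klDiv (V x) (Q x) ∂P)) :
    r ≤ ∫⁻ x, klDiv (V x) (Q₀ x) ∂P := by
  have hlim : Tendsto (fun η : ℝ => ∫⁻ x, klDiv (V x) (Q₀ x) ∂P +
      ENNReal.ofReal (Real.log ((1 - η) ^ k)⁻¹)) (𝓝[>] 0)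
      (𝓝 (∫⁻ x, klDiv (V x) (Q₀ x) ∂P + 0)) := by
    refine tendsto_const_nhds.add ?_
    have hc : ContinuousAt (fun η : ℝ => ENNReal.ofReal (Real.log ((1 - η) ^ k)⁻¹)) 0 := by
      refine ENNReal.continuous_ofReal.continuousAt.comp (ContinuousAt.log ?_ (by simp))
      exact ContinuousAt.inv₀ (by fun_prop) (by simp)
    have := hc.tendsto.mono_left (nhdsWithin_le_nhds (s := Set.Ioi 0))
    simpa using this
  rw [add_zero] at hlim
  refine ge_of_tendsto hlim ?_
  filter_upwards [Ioo_mem_nhdsGT (zero_lt_one (α := ℝ))] with η hη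
  obtain ⟨Q, _, hQ₀, ⟨a, ha, hV⟩, hr⟩ := h η hη.1 hη.2
  refine (hr fun x => ?_).trans ?_
  -- `Q` dominates `a • V`, so the divergence of `V` from `Q` is at most `log a⁻¹`.
  · refine ne_top_of_le_ne_top ?_ (klDiv_le_add_of_smul_le ha (hV x))
    simp
  -- `Q` dominates `(1 - η) ^ k • Q₀`, which costs a term that vanishes as `η` tends to `0`.
  · rw [← klDiv_compProd_right, ← klDiv_compProd_right]
    exact klDiv_le_add_of_smul_le (pow_pos (by linarith [hη.2]) k) (smul_compProd_right_le hQ₀)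

end Limit

/-! ### The bound without closure for finite input alphabets. -/

section Bounds

variable {X₁ X₂ X₃ Y₁ Y₂ Y₃ : Type*}
  [MeasurableSpace X₁] [StandardBorelSpace X₁] [Nonempty X₁]
  [MeasurableSpace X₂] [StandardBorelSpace X₂] [Nonempty X₂]
  [MeasurableSpace X₃] [StandardBorelSpace X₃] [Nonempty X₃]
  [MeasurableSpace Y₁] [StandardBorelSpace Y₁] [Nonempty Y₁]
  [MeasurableSpace Y₂] [StandardBorelSpace Y₂] [Nonempty Y₂]
  [MeasurableSpace Y₃] [StandardBorelSpace Y₃] [Nonempty Y₃]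
  [Finite X₁] [Finite X₂] [Finite X₃]

/-- For finite input alphabets the test bounds pass to the limit of the input laws. -/
lemma testBounds_of_tendsto {P : ℕ → Measure (X₁ × X₂ × X₃)} {P' : Measure (X₁ × X₂ × X₃)}
    [IsProbabilityMeasure P'] (hP : ∀ x, Tendsto (fun n => P n {x}) atTop (𝓝 (P' {x})))
    {δ : ℕ → ℝ≥0∞} (hδ : Tendsto δ atTop (𝓝 0)) {V : Kernel (X₁ × X₂ × X₃) (Y₁ × Y₂ × Y₃)}
    [IsMarkovKernel V] {R : ℝ × ℝ × ℝ} (h : ∀ᶠ n in atTop, TestBounds (P n) V R (δ n)) :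
    TestBounds P' V R 0 := by
  constructor
  · intro q₁ _
    rw [add_zero]
    refine le_lintegral_klDiv_of_approx (Q₀ := Kernel.const _ q₁) 1 fun η hη hη1 => ?_
    -- A measure is mixed as a kernel on one point. The mixture runs over the output laws at all
    -- inputs, which is possible because there are finitely many.
    obtain ⟨q, _, hq, a, ha, hqV⟩ := exists_mixture (Kernel.const Unit q₁)
      (fun x => Kernel.const Unit (V.fst x)) hη hη1
    refine ⟨Kernel.const _ (q ()), inferInstance, fun x => ?_, ⟨a, ha, fun x => hqV x ()⟩,
      fun hfin => le_lintegral_of_tendsto hP hδ hfin (h.mono fun n hn => hn.rate₁ (q ()))⟩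
    rw [pow_one]; exact hq ()
  · intro q₂ _
    rw [add_zero]
    refine le_lintegral_klDiv_of_approx 1 fun η hη hη1 => ?_
    obtain ⟨q, _, hq, a, ha, hqV⟩ := exists_mixture q₂
      (fun x => Kernel.const X₁ (V.snd.fst x)) hη hη1
    refine ⟨testKernel₂ X₂ X₃ q, inferInstance, fun x => ?_, ⟨a, ha, fun x => hqV x x.1⟩,
      fun hfin => le_lintegral_of_tendsto hP hδ hfin (h.mono fun n hn => hn.rate₂ q)⟩
    rw [pow_one]; exact hq x.1
  · intro q₃ _
    rw [add_zero]
    refine le_lintegral_klDiv_of_approx 1 fun η hη hη1 => ?_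
    obtain ⟨q, _, hq, a, ha, hqV⟩ := exists_mixture q₃
      (fun x => Kernel.const (X₁ × X₂) (V.snd.snd x)) hη hη1
    refine ⟨testKernel₃ X₃ q, inferInstance, fun x => ?_, ⟨a, ha, fun x => hqV x (x.1, x.2.1)⟩,
      fun hfin => le_lintegral_of_tendsto hP hδ hfin (h.mono fun n hn => hn.rate₃ q)⟩
    rw [pow_one]; exact hq (x.1, x.2.1)
  · intro q₂ _ q₃ _
    rw [add_zero]
    refine le_lintegral_klDiv_of_approx 2 fun η hη hη1 => ?_
    obtain ⟨q, _, hq, a, ha, hqV⟩ := exists_mixture q₂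
      (fun x => Kernel.const X₁ (V.snd.fst x)) hη hη1
    -- The full input `x` is the mixture index and not an argument, so the mixture keeps the form of
    -- a test kernel and yet dominates the conditional law of `Y₃` at every input.
    obtain ⟨q', _, hq', a', ha', hqV'⟩ := exists_mixture q₃
      (fun x => V.snd.condKernel.comap (fun p : X₁ × X₂ × Y₂ => (x, p.2.2)) (by fun_prop)) hη hη1
    refine ⟨testKernel₂₃ X₃ q q', inferInstance, fun x => ?_,
      ⟨a * a', mul_pos ha ha', fun x => ?_⟩,
      fun hfin => le_lintegral_of_tendsto hP hδ hfin (h.mono fun n hn => hn.rate₂₃ q q')⟩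
    · rw [pow_two]
      exact smul_compProd_le (by linarith) (hq x.1) (fun y => hq' (x.1, x.2.1, y))
    · conv_lhs => rw [← V.snd.disintegrate V.snd.condKernel]
      exact smul_compProd_le ha.le (hqV x x.1) (fun y => hqV' x (x.1, x.2.1, y))
  · intro q₁ _ q₂ _ q₃ _
    rw [add_zero]
    refine le_lintegral_klDiv_of_approx 3 fun η hη hη1 => ?_
    obtain ⟨q, _, hq, a, ha, hqV⟩ := exists_mixture (Kernel.const Unit q₁)
      (fun x => Kernel.const Unit (V.fst x)) hη hη1
    obtain ⟨q', _, hq', a', ha', hqV'⟩ := exists_mixture q₂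
      (fun x => V.condKernel.fst.comap (fun p : X₁ × Y₁ => (x, p.2)) (by fun_prop)) hη hη1
    obtain ⟨q'', _, hq'', a'', ha'', hqV''⟩ := exists_mixture q₃
      (fun x => V.condKernel.condKernel.comap
        (fun p : X₁ × Y₁ × X₂ × Y₂ => ((x, p.2.1), p.2.2.2)) (by fun_prop)) hη hη1
    refine ⟨testKernel₁₂₃ X₃ (q ()) q' q'', inferInstance, fun x => ?_,
      ⟨a * (a' * a''), by positivity, fun x => ?_⟩,
      fun hfin => le_lintegral_of_tendsto hP hδ hfin
        (h.mono fun n hn => hn.rate₁₂₃ (q ()) q' q'')⟩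
    · rw [pow_succ', pow_two]
      exact smul_compProd_le (by linarith) (hq ()) fun y =>
        smul_compProd_le (by linarith) (hq' (x.1, y)) fun z => hq'' (x.1, y, x.2.1, z)
    · conv_lhs =>
        rw [← V.disintegrate V.condKernel, ← V.condKernel.disintegrate V.condKernel.condKernel]
      exact smul_compProd_le ha.le (hqV x ()) fun y =>
        smul_compProd_le ha'.le (hqV' x (x.1, y)) fun z => hqV'' x (x.1, y, x.2.1, z)

/-- Compactness of the probability simplex. -/
lemma exists_subseq_tendsto_measure {X : Type*} [Finite X] [MeasurableSpace X]
    [MeasurableSingletonClass X] (P : ℕ → Measure X) (hP : ∀ n, IsProbabilityMeasure (P n)) :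
    ∃ (P' : Measure X) (φ : ℕ → ℕ), IsProbabilityMeasure P' ∧ StrictMono φ ∧
      ∀ x, Tendsto (fun n => P (φ n) {x}) atTop (𝓝 (P' {x})) := by
  have := Fintype.ofFinite X
  have hsum (n : ℕ) : ∑ x, (P n).real {x} = 1 := by
    rw [sum_measureReal_singleton]; simp
  obtain ⟨p, hp, φ, hφ, hlim⟩ := (isCompact_stdSimplex ℝ X).tendsto_subseq
    (x := fun n x => (P n).real {x}) fun n => ⟨fun x => measureReal_nonneg, hsum n⟩
  rw [tendsto_pi_nhds] at hlim
  have hp' (x : X) : (∑ y, ENNReal.ofReal (p y) • Measure.dirac y) {x} = ENNReal.ofReal (p x) := by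
    classical
    simp only [Measure.finsetSum_apply, Measure.smul_apply, smul_eq_mul,
      Measure.dirac_apply' _ (measurableSet_singleton x), Set.indicator_apply,
      Set.mem_singleton_iff]
    simp
  refine ⟨∑ y, ENNReal.ofReal (p y) • Measure.dirac y, φ, ⟨?_⟩, hφ, fun x => ?_⟩
  · simp only [Measure.finsetSum_apply, Measure.smul_apply, measure_univ, smul_eq_mul, mul_one]
    rw [← ENNReal.ofReal_sum_of_nonneg fun x _ => hp.1 x, hp.2, ENNReal.ofReal_one]
  · rw [hp']
    have := (ENNReal.continuous_ofReal.tendsto _).comp (hlim x)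
    refine this.congr fun n => ?_
    simp

theorem capacityRegion_subset_outerRegion
    (W : Kernel (X₁ × X₂ × X₃) (Y₁ × Y₂ × Y₃)) [IsMarkovKernel W] :
    capacityRegion W ⊆ outerRegion W := by
  intro R hR
  obtain ⟨P, δ, hδ, h⟩ := exists_testBounds W hR
  -- The shift by one skips block length `0`, for which `exists_testBounds` promises nothing.
  obtain ⟨P', φ, hP', hφ, hlim⟩ := exists_subseq_tendsto_measure (fun n => P (n + 1))
    fun n => (h (n + 1) n.succ_ne_zero).1
  refine ⟨P', hP', fun V _ hVW => ?_⟩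
  have hT : TestBounds P' V R 0 := testBounds_of_tendsto hlim
    (δ := fun n => δ (φ n + 1))
    (hδ.comp ((tendsto_add_atTop_nat 1).comp hφ.tendsto_atTop))
    (Eventually.of_forall fun n => (h (φ n + 1) (Nat.succ_ne_zero _)).2 V hVW)
  simpa using hT.rateBounds le_rfl zero_le

end Bounds

/-! ### Informations under relabelling and on one-point spaces. -/

section Transport

variable {Ω Ω' α β β' γ : Type*} [MeasurableSpace Ω] [MeasurableSpace Ω'] [MeasurableSpace α]
  [MeasurableSpace β] [MeasurableSpace β'] [MeasurableSpace γ]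

lemma mutualInfo_map (μ : Measure Ω) {Φ : Ω → Ω'} (hΦ : Measurable Φ) {A : Ω' → α} {B : Ω' → β}
    (hA : Measurable A) (hB : Measurable B) :
    mutualInfo (μ.map Φ) A B = mutualInfo μ (A ∘ Φ) (B ∘ Φ) := by
  rw [mutualInfo, mutualInfo, Measure.map_map hA hΦ, Measure.map_map hB hΦ,
    Measure.map_map (hA.prodMk hB) hΦ]
  rfl

lemma condMutualInfo_map [StandardBorelSpace α] [Nonempty α] [StandardBorelSpace β] [Nonempty β]
    (μ : Measure Ω) [IsProbabilityMeasure μ] {Φ : Ω → Ω'} (hΦ : Measurable Φ) {A : Ω' → α}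
    {B : Ω' → β} {C : Ω' → γ} (hA : Measurable A) (hB : Measurable B) (hC : Measurable C) :
    condMutualInfo (μ.map Φ) A B C = condMutualInfo μ (A ∘ Φ) (B ∘ Φ) (C ∘ Φ) := by
  rw [condMutualInfo, condMutualInfo]
  simp only [condDistrib]
  rw [Measure.map_map hC hΦ, Measure.map_map (hC.prodMk (hA.prodMk hB)) hΦ]
  have h1 : (μ.map Φ).map (fun a => (C a, A a)) = μ.map fun a => ((C ∘ Φ) a, (A ∘ Φ) a) :=
    Measure.map_map (hC.prodMk hA) hΦ
  have h2 : (μ.map Φ).map (fun a => (C a, B a)) = μ.map fun a => ((C ∘ Φ) a, (B ∘ Φ) a) :=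
    Measure.map_map (hC.prodMk hB) hΦ
  simp only [h1, h2]
  rfl

lemma mutualInfo_comp_right (μ : Measure Ω) [IsProbabilityMeasure μ] {A : Ω → α} {B : Ω → β}
    (hA : Measurable A) (hB : Measurable B) {g : β → β'} {g' : β' → β} (hg : Measurable g)
    (hg' : Measurable g') (h : Function.LeftInverse g' g) :
    mutualInfo μ A (fun ω => g (B ω)) = mutualInfo μ A B := by
  have := Measure.isProbabilityMeasure_map (μ := μ) hA.aemeasurable
  have := Measure.isProbabilityMeasure_map (μ := μ) hB.aemeasurable
  have h1 : μ.map (fun ω => (A ω, g (B ω))) = (μ.map fun ω => (A ω, B ω)).map (Prod.map id g) := by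
    rw [Measure.map_map (by fun_prop) (by fun_prop)]
    rfl
  have h2 : μ.map (fun ω => g (B ω)) = (μ.map B).map g := (Measure.map_map hg hB).symm
  have h3 : (μ.map A).prod ((μ.map B).map g)
      = ((μ.map A).prod (μ.map B)).map (Prod.map id g) := by
    rw [← Measure.map_prod_map _ _ measurable_id hg, Measure.map_id]
  rw [mutualInfo, mutualInfo, h1, h2, h3,
    klDiv_map_of_leftInverse (f := Prod.map id g) (g := Prod.map id g') (by fun_prop) (by fun_prop)
      (fun p => Prod.ext rfl (h p.2))]

lemma condMutualInfo_comp_right [StandardBorelSpace α] [Nonempty α] [StandardBorelSpace β]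
    [Nonempty β] [StandardBorelSpace β'] [Nonempty β'] (μ : Measure Ω) [IsProbabilityMeasure μ]
    {A : Ω → α} {B : Ω → β} {C : Ω → γ} (hA : Measurable A) (hB : Measurable B)
    (hC : Measurable C) {g : β → β'} {g' : β' → β} (hg : Measurable g) (hg' : Measurable g')
    (h : Function.LeftInverse g' g) (h' : Function.RightInverse g' g) :
    condMutualInfo μ A (fun ω => g (B ω)) C = condMutualInfo μ A B C := by
  refine (ENNReal.mul_left_inj ofReal_log_two_ne_zero ENNReal.ofReal_ne_top).1 ?_
  rw [condMutualInfo_mul_log_two (D := fun ω => (C ω, B ω)) (f := Prod.fst)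
      (g := Prod.map id g') (e := Prod.map id g) μ hA (by fun_prop) hC (by fun_prop) (by fun_prop)
      (by fun_prop) (fun _ => rfl) (fun p => Prod.ext rfl (h' p.2))
      (fun ω => Prod.ext rfl (h (B ω)).symm),
    condMutualInfo_mul_log_two (D := fun ω => (C ω, B ω)) (f := Prod.fst)
      (g := id) (e := id) μ hA (by fun_prop) hC (by fun_prop) (by fun_prop)
      (by fun_prop) (fun _ => rfl) (fun _ => rfl) (fun _ => rfl)]

lemma measure_eq_of_subsingleton [Subsingleton α] (μ ν : Measure α) [IsProbabilityMeasure μ]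
    [IsProbabilityMeasure ν] : μ = ν := by
  ext s
  induction s using Subsingleton.set_cases <;> simp

/-- All probability measures on a one-point space agree, so the joint conditional law is already the
product. -/
lemma condMutualInfo_eq_zero_of_subsingleton [StandardBorelSpace α] [Nonempty α]
    [StandardBorelSpace β] [Nonempty β] [Subsingleton α] [Subsingleton β] (μ : Measure Ω)
    [IsProbabilityMeasure μ] {A : Ω → α} {B : Ω → β} {C : Ω → γ} (hA : Measurable A)
    (hB : Measurable B) (hC : Measurable C) : condMutualInfo μ A B C = 0 := by
  have := Measure.isProbabilityMeasure_map (μ := μ) hC.aemeasurable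
  have h : condDistrib A C μ ×ₖ condDistrib B C μ = condDistrib (fun ω => (A ω, B ω)) C μ := by
    ext1 c
    exact measure_eq_of_subsingleton _ _
  rw [condMutualInfo, h, ← compProd_map_condDistrib (hA.prodMk hB).aemeasurable, klDiv_self,
    ENNReal.zero_div]

end Transport

/-! ### Reduction to two users. -/

section TrivialUser

variable {X₁ X₂ Y₁ Y₂ : Type*}
  [MeasurableSpace X₁] [MeasurableSpace X₂] [MeasurableSpace Y₁] [MeasurableSpace Y₂]

instance (W : Kernel (X₁ × X₂) (Y₁ × Y₂)) [IsMarkovKernel W] :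
    IsMarkovKernel (addTrivialUser W) := by
  rw [addTrivialUser]
  exact Kernel.IsMarkovKernel.map _ (by fun_prop)

lemma fst_addTrivialUser (W : Kernel (X₁ × X₂) (Y₁ × Y₂)) (x : X₁ × X₂ × Unit) :
    (addTrivialUser W).fst x = W.fst (x.1, x.2.1) := by
  rw [addTrivialUser, Kernel.fst_apply, Kernel.map_apply _ (by fun_prop), Kernel.comap_apply,
    Kernel.fst_apply, Measure.map_map (by fun_prop) (by fun_prop)]
  rfl

lemma snd_fst_addTrivialUser (W : Kernel (X₁ × X₂) (Y₁ × Y₂)) (x : X₁ × X₂ × Unit) :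
    (addTrivialUser W).snd.fst x = W.snd (x.1, x.2.1) := by
  rw [addTrivialUser, Kernel.fst_apply, Kernel.snd_apply, Kernel.map_apply _ (by fun_prop),
    Kernel.comap_apply, Kernel.snd_apply, Measure.map_map (by fun_prop) (by fun_prop),
    Measure.map_map (by fun_prop) (by fun_prop)]
  rfl

lemma sameMarginals_addTrivialUser_iff (W V : Kernel (X₁ × X₂) (Y₁ × Y₂)) [IsMarkovKernel W]
    [IsMarkovKernel V] :
    SameMarginals (addTrivialUser W) (addTrivialUser V) ↔ V.fst = W.fst ∧ V.snd = W.snd := by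
  constructor
  · rintro ⟨h1, h2, -⟩
    constructor
    · ext1 x
      rw [← fst_addTrivialUser V (x.1, x.2, ()), h1, fst_addTrivialUser]
    · ext1 x
      rw [← snd_fst_addTrivialUser V (x.1, x.2, ()), h2, snd_fst_addTrivialUser]
  · rintro ⟨h1, h2⟩
    refine ⟨?_, ?_, ?_⟩
    · ext1 x
      rw [fst_addTrivialUser, fst_addTrivialUser, h1]
    · ext1 x
      rw [snd_fst_addTrivialUser, snd_fst_addTrivialUser, h2]
    · ext1 x
      exact measure_eq_of_subsingleton _ _

/-- Every channel whose third user has one-point alphabets comes from a two-user channel. -/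
lemma exists_addTrivialUser_eq (V : Kernel (X₁ × X₂ × Unit) (Y₁ × Y₂ × Unit)) [IsMarkovKernel V] :
    ∃ V₂ : Kernel (X₁ × X₂) (Y₁ × Y₂), IsMarkovKernel V₂ ∧ addTrivialUser V₂ = V := by
  refine ⟨(V.comap (fun x : X₁ × X₂ => (x.1, x.2, ())) (by fun_prop)).map
    (fun y => (y.1, y.2.1)), Kernel.IsMarkovKernel.map _ (by fun_prop), ?_⟩
  ext1 x
  rw [addTrivialUser, Kernel.map_apply _ (by fun_prop), Kernel.comap_apply,
    Kernel.map_apply _ (by fun_prop), Kernel.comap_apply,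
    Measure.map_map (by fun_prop) (by fun_prop)]
  exact Measure.map_id

lemma compProd_addTrivialUser (P : Measure (X₁ × X₂)) [IsProbabilityMeasure P]
    (V : Kernel (X₁ × X₂) (Y₁ × Y₂)) [IsMarkovKernel V] :
    (P.map fun x => (x.1, x.2, ())) ⊗ₘ addTrivialUser V =
      (P ⊗ₘ V).map fun ω => ((ω.1.1, ω.1.2, ()), (ω.2.1, ω.2.2, ())) := by
  have := Measure.isProbabilityMeasure_map (μ := P)
    (f := fun x : X₁ × X₂ => (x.1, x.2, ())) (by fun_prop)
  ext s hs
  rw [Measure.map_apply (by fun_prop) hs, Measure.compProd_apply hs,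
    Measure.compProd_apply (hs.preimage (by fun_prop)),
    lintegral_map (Kernel.measurable_kernel_prodMk_left hs) (by fun_prop)]
  refine lintegral_congr fun x => ?_
  rw [addTrivialUser, Kernel.map_apply _ (by fun_prop), Kernel.comap_apply,
    Measure.map_apply (by fun_prop) (measurable_prodMk_left hs)]
  rfl

variable [StandardBorelSpace X₁] [Nonempty X₁] [StandardBorelSpace X₂] [Nonempty X₂]
  [StandardBorelSpace Y₁] [Nonempty Y₁] [StandardBorelSpace Y₂] [Nonempty Y₂]

lemma rateBounds_addTrivialUser_iff (P : Measure (X₁ × X₂)) [IsProbabilityMeasure P]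
    (P' : Measure (X₁ × X₂ × Unit)) [IsProbabilityMeasure P']
    (hP : P' = P.map fun x => (x.1, x.2, ())) (V : Kernel (X₁ × X₂) (Y₁ × Y₂)) [IsMarkovKernel V]
    (R₁ R₂ : ℝ) :
    RateBounds P' (addTrivialUser V) (R₁, R₂, 0) ↔
      ENNReal.ofReal R₁ ≤ mutualInfo (P ⊗ₘ V) (fun ω => ω.2.1) (fun ω => ω.1) ∧
      ENNReal.ofReal R₂ ≤
        condMutualInfo (P ⊗ₘ V) (fun ω => ω.2.2) (fun ω => ω.1.2) (fun ω => ω.1.1) ∧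
      ENNReal.ofReal (R₁ + R₂) ≤
        mutualInfo (P ⊗ₘ V) (fun ω => ω.2.1) (fun ω => ω.1) +
        condMutualInfo (P ⊗ₘ V) (fun ω => ω.2.2) (fun ω => ω.1.2) (fun ω => (ω.1.1, ω.2.1)) := by
  have hμ : P' ⊗ₘ addTrivialUser V =
      (P ⊗ₘ V).map fun ω => ((ω.1.1, ω.1.2, ()), (ω.2.1, ω.2.2, ())) := by
    rw [hP, compProd_addTrivialUser]
  have e₁ : mutualInfo (P' ⊗ₘ addTrivialUser V) (fun ω => ω.2.1) (fun ω => ω.1) =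
      mutualInfo (P ⊗ₘ V) (fun ω => ω.2.1) (fun ω => ω.1) := by
    rw [hμ, mutualInfo_map _ (by fun_prop) (by fun_prop) (by fun_prop)]
    exact mutualInfo_comp_right (P ⊗ₘ V) (A := fun ω => ω.2.1) (B := fun ω => ω.1)
      (g := fun x : X₁ × X₂ => (x.1, x.2, ())) (g' := fun x => (x.1, x.2.1)) (by fun_prop) (by fun_prop) (by fun_prop) (by fun_prop)
      (fun _ => rfl)
  have e₂ : condMutualInfo (P' ⊗ₘ addTrivialUser V) (fun ω => ω.2.2.1) (fun ω => ω.1.2)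
      (fun ω => ω.1.1) =
      condMutualInfo (P ⊗ₘ V) (fun ω => ω.2.2) (fun ω => ω.1.2) (fun ω => ω.1.1) := by
    simp only [hμ]
    rw [condMutualInfo_map _ (by fun_prop) (by fun_prop) (by fun_prop) (by fun_prop)]
    exact condMutualInfo_comp_right (P ⊗ₘ V) (g := fun x => (x, ()))
      (g' := fun x => x.1) (by fun_prop) (by fun_prop) (by fun_prop) (by fun_prop) (by fun_prop)
      (fun _ => rfl) (fun _ => rfl)
  have e₃ : condMutualInfo (P' ⊗ₘ addTrivialUser V) (fun ω => ω.2.2.1) (fun ω => ω.1.2)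
      (fun ω => (ω.1.1, ω.2.1)) =
      condMutualInfo (P ⊗ₘ V) (fun ω => ω.2.2) (fun ω => ω.1.2) (fun ω => (ω.1.1, ω.2.1)) := by
    simp only [hμ]
    rw [condMutualInfo_map _ (by fun_prop) (by fun_prop) (by fun_prop) (by fun_prop)]
    exact condMutualInfo_comp_right (P ⊗ₘ V) (g := fun x => (x, ()))
      (g' := fun x => x.1) (by fun_prop) (by fun_prop) (by fun_prop) (by fun_prop) (by fun_prop)
      (fun _ => rfl) (fun _ => rfl)
  have e₄ : condMutualInfo (P' ⊗ₘ addTrivialUser V) (fun ω => ω.2.2.2) (fun ω => ω.1.2.2)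
      (fun ω => (ω.1.1, ω.2.1, ω.1.2.1, ω.2.2.1)) = 0 :=
    condMutualInfo_eq_zero_of_subsingleton _ (by fun_prop) (by fun_prop) (by fun_prop)
  constructor
  · intro h
    refine ⟨e₁ ▸ h.rate₁, e₂ ▸ h.rate₂, ?_⟩
    have h₃ := h.rate₁₂₃
    rwa [e₁, e₃, e₄, add_zero, add_zero] at h₃
  · rintro ⟨h₁, h₂, h₃⟩
    -- With third rate `0` the third bound is void, and the bound on `R₂ + R₃` follows from the one
    -- on `R₂`.
    refine ⟨e₁ ▸ h₁, e₂ ▸ h₂, by simp, ?_, ?_⟩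
    · rw [e₂, add_zero]
      exact h₂.trans le_self_add
    · rwa [e₁, e₃, e₄, add_zero, add_zero]

theorem mem_outerRegion_addTrivialUser_iff (W : Kernel (X₁ × X₂) (Y₁ × Y₂)) [IsMarkovKernel W]
    (R₁ R₂ : ℝ) :
    (R₁, R₂, (0 : ℝ)) ∈ outerRegion (addTrivialUser W) ↔ (R₁, R₂) ∈ twoUserOuterRegion W := by
  constructor
  · rintro ⟨P', hP', h⟩
    have hP := Measure.isProbabilityMeasure_map (μ := P')
      (f := fun x : X₁ × X₂ × Unit => (x.1, x.2.1)) (by fun_prop)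
    have hPP' : P' = (P'.map fun x => (x.1, x.2.1)).map fun x => (x.1, x.2, ()) := by
      rw [Measure.map_map (by fun_prop) (by fun_prop)]
      exact Measure.map_id.symm
    refine ⟨_, hP, fun V hV h₁ h₂ => ?_⟩
    exact (rateBounds_addTrivialUser_iff _ P' hPP' V R₁ R₂).1
      (h _ inferInstance ((sameMarginals_addTrivialUser_iff W V).2 ⟨h₁, h₂⟩))
  · rintro ⟨P, hP, h⟩
    have hP' := Measure.isProbabilityMeasure_map (μ := P)
      (f := fun x : X₁ × X₂ => (x.1, x.2, ())) (by fun_prop)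
    refine ⟨_, hP', fun V' hV' hVW => ?_⟩
    obtain ⟨V, hV, rfl⟩ := exists_addTrivialUser_eq V'
    obtain ⟨h₁, h₂⟩ := (sameMarginals_addTrivialUser_iff W V).1 hVW
    exact (rateBounds_addTrivialUser_iff P _ rfl V R₁ R₂).2 (h V hV h₁ h₂)

end TrivialUser

end CIFC

end

theorem mainTheorem2 {X₁ X₂ X₃ Y₁ Y₂ Y₃ : Type*}
    [MeasurableSpace X₁] [StandardBorelSpace X₁] [Nonempty X₁]
    [MeasurableSpace X₂] [StandardBorelSpace X₂] [Nonempty X₂]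
    [MeasurableSpace X₃] [StandardBorelSpace X₃] [Nonempty X₃]
    [MeasurableSpace Y₁] [StandardBorelSpace Y₁] [Nonempty Y₁]
    [MeasurableSpace Y₂] [StandardBorelSpace Y₂] [Nonempty Y₂]
    [MeasurableSpace Y₃] [StandardBorelSpace Y₃] [Nonempty Y₃]
    (W : Kernel (X₁ × X₂ × X₃) (Y₁ × Y₂ × Y₃)) [IsMarkovKernel W] :
    CIFC.capacityRegion W ⊆ closure (CIFC.outerRegion W) ∧
    (Finite X₁ → Finite X₂ → Finite X₃ → CIFC.capacityRegion W ⊆ CIFC.outerRegion W) ∧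
    (∀ (W₂ : Kernel (X₁ × X₂) (Y₁ × Y₂)) [IsMarkovKernel W₂] (R₁ R₂ : ℝ),
      (R₁, R₂, (0 : ℝ)) ∈ CIFC.outerRegion (CIFC.addTrivialUser W₂) ↔
        (R₁, R₂) ∈ CIFC.twoUserOuterRegion W₂) := by
  exact ⟨CIFC.capacityRegion_subset_closure_outerRegion W,
    fun _ _ _ => CIFC.capacityRegion_subset_outerRegion W,
    fun W₂ _ R₁ R₂ => CIFC.mem_outerRegion_addTrivialUser_iff W₂ R₁ R₂⟩
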